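/- Throughout, strings are elements of $2^{<\mathbb N}$, $\Lambda$ is the empty string, $2^{\mathbb N}$ is Cantor space, and $[\![\sigma]\!]$ is the set of $X\in 2^{\mathbb N}$ that extend the string $\sigma$. Let $U$ be any universal (i.e. additively optimal) prefix-free machine and $\mathrm K(\sigma)=\min\{|\tau| : U(\tau)=\sigma\}$. A *continuous semimeasure* is a map $\rho:2^{<\mathbb N}\to[0,1]$ with $\rho(\Lambda)=1$ and $\rho(\sigma)\ge\rho(\sigma0)+\rho(\sigma1)$ for all $\sigma$; let $\mathbf M$ be any universal lower semicomputable continuous semimeasure, i.e. one such that every lower semicomputable continuous semimeasure $\rho$ satisfies $\rho\le c\,\mathbf M$ for some $c\in\mathbb N$. A class $\mathcal C\subseteq 2^{\mathbb N}$ is $\Pi^0_1$ if it is the complement of $\bigcup_{\sigma\in S}[\![\sigma]\!]$ for some c.e. set $S$ of strings. Let $T_n$ be the set of strings of length $n$ that are a prefix of some member of $\mathcal C$. The class $\mathcal C$ is *deep* if it is $\Pi^0_1$ and there is a computable, non-decreasing, unbounded $h:\mathbb N\to\mathbb N$ such that $\sum_{\sigma\in T_n}\mathbf M(\sigma)\le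 2^{-h(n)}$ for all $n$. Depth of a class of other objects means that the class of their codes in $2^{\mathbb N}$ is deep, where a sequence $(F_i)$ of finite sets of strings is coded by the characteristic sequence of $\{(i,\sigma):\sigma\in F_i\}$, a function $g:2^{<\mathbb N}\to\mathbb N$ by that of its graph, and a dyadic-valued function $D$ on strings by that of $\{(\sigma,m,s)\in 2^{<\mathbb N}\times\mathbb N\times\mathbb N : D(\sigma)=m/2^s\}$, with respect to standard numberings of pairs, triples and strings. **Theorem.** 1. Let $f,\ell,d:\mathbb N\to\mathbb N$ be computable functions such that $\ell$ is non-decreasing and $f(i)/2^{d(i)}$ takes arbitrarily large values. Let $\mathcal K_{f,\ell,d}$ be the class of sequences $(F_i)_{i\in\mathbb N}$ such that, for every $i$, $F_i$ is a set of exactly $f(i)$ strings $\sigma$ of length $\ell(i)$ with $\mathrm K(\sigma)\ge \ell(i)-d(i)$. Then $\mathcal K_{f,\ell,d}$ is deep. 2. For every $c\in\mathbb N$, the class $\mathcal{CF}_c$ of functions $g:2^{<\mathbb N}\to\mathbb N$ such that $g(\sigma)\le \mathrm K(\sigma)+c$ for all $\sigma$ and $\sum_\sigma 2^{-g(\sigma)}\le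 1$ is deep. 3. Let $g:\mathbb N\to\mathbb N$ be computable and let $r>0$ be rational. Fix any computable coding of nonnegative dyadic rationals by strings, i.e. a computable $\nu:2^{<\mathbb N}\to\mathbb N\times\mathbb N$ where $\tau$ with $\nu(\tau)=(m,s)$ is a code of $m/2^s$. Let $\mathcal W_{g,r}$ be the class of nonnegative dyadic-valued $D$ on $2^{<\mathbb N}$ with $2D(\sigma)=D(\sigma0)+D(\sigma1)$ for all $\sigma$ (martingales), $D(\Lambda)=1$, $D(\sigma)>1+r$ for all $\sigma$ with $\mathrm K(\sigma)<|\sigma|$, and such that every $D(\sigma)$ has a code of length $g(|\sigma|)$. Then $\mathcal W_{g,r}$ is deep. -/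

import Mathlib

namespace DeepClasses

/-! Finite binary strings are `List Bool` (first bit first), infinite binary sequences are
`ℕ → Bool`. -/

/-- `X ↾ n`, the string of the first `n` bits of `X`. -/
def restr (X : ℕ → Bool) (n : ℕ) : List Bool := (List.range n).map X

/-- The cylinder of all sequences that have `σ` as a prefix. -/
def cylinder (σ : List Bool) : Set (ℕ → Bool) := {X | restr X σ.length = σ}

/-- Effectively closed classes: complements of `⋃ σ ∈ S, cylinder σ` with `S` computably
enumerable. -/
def IsPi01 (C : Set (ℕ → Bool)) : Prop :=
  ∃ S : Set (List Bool), REPred (fun σ => σ ∈ S) ∧ C = (⋃ σ ∈ S, cylinder σ)ᶜ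

/-- The canonical co-c.e. tree of `C`: the strings that are a prefix of some member of `C`. -/
def canonicalTree (C : Set (ℕ → Bool)) : Set (List Bool) := {σ | (cylinder σ ∩ C).Nonempty}

/-- The `n`-th level of a tree. -/
def level (T : Set (List Bool)) (n : ℕ) : Set (List Bool) := {σ | σ ∈ T ∧ σ.length = n}

/-- The dyadic rational `m / 2 ^ s` denoted by a pair `(m, s)`. -/
def dyadic (p : ℕ × ℕ) : ℚ := (p.1 : ℚ) / 2 ^ p.2

/-- Lower semicomputability of a nonnegative function on strings: it is the pointwise limit of a
computable, nondecreasing sequence of dyadic rationals. -/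
def LowerSemicomputable (ρ : List Bool → ℝ) : Prop :=
  ∃ a : List Bool → ℕ → ℕ × ℕ, Computable₂ a ∧
    (∀ σ, Monotone fun i => dyadic (a σ i)) ∧
    ∀ σ, Filter.Tendsto (fun i => ((dyadic (a σ i) : ℚ) : ℝ)) Filter.atTop (nhds (ρ σ))

/-- Continuous semimeasures. -/
structure IsSemimeasure (ρ : List Bool → ℝ) : Prop where
  nonneg : ∀ σ, 0 ≤ ρ σ
  root : ρ [] = 1
  split : ∀ σ, ρ (σ ++ [false]) + ρ (σ ++ [true]) ≤ ρ σ

/-- Universal lower semicomputable continuous semimeasures. -/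
structure IsUniversalSemimeasure (M : List Bool → ℝ) : Prop where
  semimeasure : IsSemimeasure M
  lowerSemicomputable : LowerSemicomputable M
  dominates : ∀ ρ : List Bool → ℝ, IsSemimeasure ρ → LowerSemicomputable ρ →
    ∃ c : ℕ, ∀ σ, ρ σ ≤ c * M σ

/-- Computable orders: computable, nondecreasing and unbounded functions. -/
structure IsComputableOrder (h : ℕ → ℕ) : Prop where
  computable : Computable h
  monotone : Monotone h
  unbounded : ∀ k, ∃ n, k ≤ h n

/-- Depth of an effectively closed class, with respect to the universal semimeasure `M`. The
inequality is not strict, because `M [] = 1`: at `n = 0` the strict one would fail for every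
nonempty class. -/
def IsDeep (M : List Bool → ℝ) (C : Set (ℕ → Bool)) : Prop :=
  IsPi01 C ∧ ∃ h : ℕ → ℕ, IsComputableOrder h ∧
    ∀ n, ∑' σ : level (canonicalTree C) n, M σ ≤ (1 / 2 : ℝ) ^ h n

/-- Prefix-free machines: partial computable functions on strings whose domain is prefix-free. -/
structure IsPrefixFreeMachine (V : List Bool →. List Bool) : Prop where
  partrec : Partrec V
  prefixFree : ∀ σ τ, (V σ).Dom → (V τ).Dom → σ <+: τ → σ = τ

/-- Universal (optimal) prefix-free machines: every prefix-free machine is simulated with descriptions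
that are longer by at most an additive constant. Machines that are universal by
adjunction, `U (ρ ++ τ) = V τ` for a fixed `ρ` depending on `V`, are of this kind. -/
structure IsUniversalMachine (U : List Bool →. List Bool) : Prop where
  machine : IsPrefixFreeMachine U
  optimal : ∀ V, IsPrefixFreeMachine V →
    ∃ c : ℕ, ∀ τ σ, σ ∈ V τ → ∃ τ', σ ∈ U τ' ∧ τ'.length ≤ τ.length + c

/-- Prefix-free complexity: the least length of a `U`-description of `σ` (one exists whenever `U`
is universal). -/
noncomputable def complexity (U : List Bool →. List Bool) (σ : List Bool) : ℕ :=
  sInf {n | ∃ τ : List Bool, τ.length = n ∧ σ ∈ U τ}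

open Classical in
/-- The characteristic sequence of a set `A` of finite objects, through their standard codes. -/
noncomputable def charSeq {α : Type} [Primcodable α] (A : Set α) : ℕ → Bool :=
  fun n => decide (∃ a ∈ A, Encodable.encode a = n)

/-- Sequences `F` of finite sets of strings where `F i` consists of `f i` strings `σ` of length
`ℓ i` with `K σ ≥ ℓ i - d i`. -/
def ComplexSets (U : List Bool →. List Bool) (f ℓ d : ℕ → ℕ) : Set (ℕ → Finset (List Bool)) :=
  {F | ∀ i, (F i).card = f i ∧
    ∀ σ ∈ F i, σ.length = ℓ i ∧ (ℓ i : ℤ) - d i ≤ complexity U σ}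

/-- `ComplexSets` as a class of sequences: `F` is coded by its membership relation. -/
def complexSetsClass (U : List Bool →. List Bool) (f ℓ d : ℕ → ℕ) : Set (ℕ → Bool) :=
  (fun F : ℕ → Finset (List Bool) => charSeq {p : ℕ × List Bool | p.2 ∈ F p.1}) ''
    ComplexSets U f ℓ d

/-- Compression functions with constant `c`. -/
def CompressionFunctions (U : List Bool →. List Bool) (c : ℕ) : Set (List Bool → ℕ) :=
  {g | (∀ σ, g σ ≤ complexity U σ + c) ∧
    Summable (fun σ => (1 / 2 : ℝ) ^ g σ) ∧ ∑' σ, (1 / 2 : ℝ) ^ g σ ≤ 1}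

/-- `CompressionFunctions` as a class of sequences: `g` is coded by its graph. -/
def compressionClass (U : List Bool →. List Bool) (c : ℕ) : Set (ℕ → Bool) :=
  (fun g : List Bool → ℕ => charSeq {p : List Bool × ℕ | g p.1 = p.2}) ''
    CompressionFunctions U c

/-- Martingales (with finite rational values). -/
structure IsMartingale (D : List Bool → ℚ) : Prop where
  nonneg : ∀ σ, 0 ≤ D σ
  fair : ∀ σ, 2 * D σ = D (σ ++ [false]) + D (σ ++ [true])

/-- Dyadic-valued martingales `D` with `D Λ = 1`, with `D σ > 1 + r` whenever `K σ < |σ|`, and such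
that each value `D σ` has a code of `g |σ|` bits, where the string `τ` is the code of the dyadic
rational `dyadic (ν τ)`. -/
def DominatingMartingales (U : List Bool →. List Bool) (ν : List Bool → ℕ × ℕ)
    (g : ℕ → ℕ) (r : ℚ) : Set (List Bool → ℚ) :=
  {D | IsMartingale D ∧ D [] = 1 ∧
    (∀ σ : List Bool, complexity U σ < σ.length → 1 + r < D σ) ∧
    ∀ σ : List Bool, ∃ τ : List Bool, τ.length = g σ.length ∧ D σ = dyadic (ν τ)}

/-- `DominatingMartingales` as a class of sequences: `D` is coded by the set of all
triples `(σ, m, s)` with `D σ = m / 2 ^ s`. -/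
def martingaleClass (U : List Bool →. List Bool) (ν : List Bool → ℕ × ℕ)
    (g : ℕ → ℕ) (r : ℚ) : Set (ℕ → Bool) :=
  (fun D : List Bool → ℚ => charSeq {p : List Bool × ℕ × ℕ | D p.1 = dyadic p.2}) ''
    DominatingMartingales U ν g r

end DeepClasses

/-!
Suppose that the first `N` bits of each `X` in a class `C` determine a set `R X` of strings of
length `ℓ` and complexity at least `L + 2 m + 2` that has at least `2 ^ (m + ℓ - L)` elements.
Call a string `τ` of length `N` related to `σ` if `σ ∈ R X` for the `X` that extend `τ`. Enumerate
strings `σ` greedily, appending `σ` whenever the `τ` that are related to it and to no earlier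
entry have `M`-weight more than `2 ^ (-L)`. All strings of length `N` together weigh at most `1`,
so there are at most `2 ^ L` entries, and by giving its position each of them is described with
`m + L + O(1)` bits. For large `m` no entry is complex enough to lie in any `R X` with `X ∈ C`.
Hence the `τ` in level `N` of the tree of `C` are related to no entry, and since the list cannot
be extended, those related to any given `σ` weigh at most `2 ^ (-L)`. Counting pairs `(σ, τ)` in
two ways, the level weighs at most `2 ^ (-m)`.

For the three classes of the theorem, `R X` is a member `F i` of the sequence with `f i` much
larger than `2 ^ d i`; the strings with a large value of `g`, at least half of all by Kraft's
inequality; and the strings `σ` with `D σ ≤ 1 + r`, a fixed fraction of all by Markov's inequality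
for the martingale.
-/

namespace DeepClasses

open Encodable Filter Topology

section Computability

variable {α β γ : Type*} [Primcodable α] [Primcodable β] [Primcodable γ]

attribute [fun_prop] Computable Computable.id Computable.const Computable.comp Computable.pair
  Computable.fst Computable.snd Computable.cond Computable.encode Computable.decode
  Computable.unpair Computable.option_some Computable.list_length

@[fun_prop]
theorem computable_add {f g : α → ℕ} (hf : Computable f) (hg : Computable g) :
    Computable fun a => f a + g a :=
  Primrec.nat_add.to_comp.comp hf hg

@[fun_prop]
theorem computable_sub {f g : α → ℕ} (hf : Computable f) (hg : Computable g) :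
    Computable fun a => f a - g a :=
  Primrec.nat_sub.to_comp.comp hf hg

@[fun_prop]
theorem computable_mul {f g : α → ℕ} (hf : Computable f) (hg : Computable g) :
    Computable fun a => f a * g a :=
  Primrec.nat_mul.to_comp.comp hf hg

@[fun_prop]
theorem computable_pow {f g : α → ℕ} (hf : Computable f) (hg : Computable g) :
    Computable fun a => f a ^ g a :=
  (Primrec₂.unpaired'.1 Nat.Primrec.pow : Primrec₂ fun a b : ℕ => a ^ b).to_comp.comp hf hg

@[fun_prop]
theorem computable_decide_le {f g : α → ℕ} (hf : Computable f) (hg : Computable g) :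
    Computable fun a => decide (f a ≤ g a) :=
  Primrec.nat_le.decide.to_comp.comp hf hg

@[fun_prop]
theorem computable_decide_lt {f g : α → ℕ} (hf : Computable f) (hg : Computable g) :
    Computable fun a => decide (f a < g a) :=
  Primrec.nat_lt.decide.to_comp.comp hf hg

@[fun_prop]
theorem computable_beq [inst : BEq β] [LawfulBEq β] {f g : α → β} (hf : Computable f)
    (hg : Computable g) : Computable fun a => f a == g a := by
  classical
  obtain rfl : inst = instBEqOfDecidableEq := lawful_beq_subsingleton _ _
  exact Primrec.beq.to_comp.comp hf hg

theorem computable_decide_eq [DecidableEq β] {f g : α → β} (hf : Computable f)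
    (hg : Computable g) : Computable fun a => decide (f a = g a) :=
  Primrec.eq.decide.to_comp.comp hf hg

@[fun_prop]
theorem computable_and {f g : α → Bool} (hf : Computable f) (hg : Computable g) :
    Computable fun a => f a && g a :=
  Primrec.and.to_comp.comp hf hg

@[fun_prop]
theorem computable_not {f : α → Bool} (hf : Computable f) : Computable fun a => !f a :=
  Primrec.not.to_comp.comp hf

@[fun_prop]
theorem computable_append {f g : α → List β} (hf : Computable f) (hg : Computable g) :
    Computable fun a => f a ++ g a :=
  Computable.list_append.comp hf hg

@[fun_prop]
theorem computable_cons {f : α → β} {g : α → List β} (hf : Computable f) (hg : Computable g) :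
    Computable fun a => f a :: g a :=
  Computable.list_cons.comp hf hg

@[fun_prop]
theorem computable_getElem? {f : α → List β} {g : α → ℕ} (hf : Computable f)
    (hg : Computable g) : Computable fun a => (f a)[g a]? :=
  Computable.list_getElem?.comp hf hg

@[fun_prop]
theorem computable_drop {f : α → ℕ} {g : α → List β} (hf : Computable f) (hg : Computable g) :
    Computable fun a => (g a).drop (f a) :=
  Primrec.list_drop.to_comp.comp hf hg

@[fun_prop]
theorem computable_idxOf [inst : BEq β] [LawfulBEq β] {f : α → β} {g : α → List β}
    (hf : Computable f) (hg : Computable g) : Computable fun a => (g a).idxOf (f a) := by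
  classical
  obtain rfl : inst = instBEqOfDecidableEq := lawful_beq_subsingleton _ _
  exact Primrec.list_idxOf.to_comp.comp hf hg

@[fun_prop]
theorem computable_optionElim {o : α → Option β} {f : α → γ} {g : α → β → γ} (ho : Computable o)
    (hf : Computable f) (hg : Computable fun x : α × β => g x.1 x.2) :
    Computable fun a => (o a).elim (f a) (g a) :=
  (Computable.option_casesOn ho hf hg).of_eq fun a => by cases o a <;> rfl

@[fun_prop]
theorem computable_foldl {l : α → List β} {g : α → γ} {h : α → γ → β → γ} (hl : Computable l)
    (hg : Computable g) (hh : Computable fun x : α × γ × β => h x.1 x.2.1 x.2.2) :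
    Computable fun a => (l a).foldl (h a) (g a) := by
  have hstep : Computable₂ fun (a : α) (x : ℕ × γ) =>
      ((l a)[x.1]?).elim x.2 fun b => h a x.2 b := by
    have hsome : Computable fun y : (α × ℕ × γ) × β => h y.1.1 y.1.2.2 y.2 :=
      hh.comp (g := fun y : (α × ℕ × γ) × β => (y.1.1, y.1.2.2, y.2)) (by fun_prop)
    exact computable_optionElim (by fun_prop) (by fun_prop) hsome
  refine (Computable.nat_rec (f := fun a => (l a).length) (by fun_prop) hg hstep).of_eq fun a => ?_
  have htake : ∀ n ≤ (l a).length, Nat.rec (motive := fun _ => γ) (g a)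
      (fun i s => ((l a)[i]?).elim s fun b => h a s b) n = ((l a).take n).foldl (h a) (g a) := by
    intro n
    induction n with
    | zero => simp
    | succ n ih =>
      intro hn
      simp only [ih (by lia), List.getElem?_eq_getElem (show n < (l a).length by lia),
        Option.elim_some, List.take_add_one, List.foldl_append, Option.toList_some,
        List.foldl_cons, List.foldl_nil]
  simpa using htake _ le_rfl

@[fun_prop]
theorem computable_flatMap {l : α → List β} {g : α → β → List γ} (hl : Computable l)
    (hg : Computable fun x : α × β => g x.1 x.2) : Computable fun a => (l a).flatMap (g a) := by
  have hstep : Computable fun x : α × List γ × β => x.2.1 ++ g x.1 x.2.2 :=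
    computable_append (by fun_prop)
      (hg.comp (g := fun x : α × List γ × β => (x.1, x.2.2)) (by fun_prop))
  refine (computable_foldl (h := fun a s b => s ++ g a b) (g := fun _ => []) hl (by fun_prop)
    hstep).of_eq fun a => ?_
  exact List.flatMap_eq_foldl.symm

@[fun_prop]
theorem computable_map {l : α → List β} {g : α → β → γ} (hl : Computable l)
    (hg : Computable fun x : α × β => g x.1 x.2) : Computable fun a => (l a).map (g a) := by
  have : Computable fun a => (l a).flatMap fun b => [g a b] := by fun_prop
  exact this.of_eq fun a => (List.map_eq_flatMap ..).symm

@[fun_prop]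
theorem computable_filter {l : α → List β} {p : α → β → Bool} (hl : Computable l)
    (hp : Computable fun x : α × β => p x.1 x.2) : Computable fun a => (l a).filter (p a) := by
  have : Computable fun a => (l a).flatMap fun b => bif p a b then [b] else [] := by fun_prop
  refine this.of_eq fun a => ?_
  induction l a with
  | nil => rfl
  | cons b l ih => cases h : p a b <;> simp [h, ih]

@[fun_prop]
theorem computable_all {l : α → List β} {p : α → β → Bool} (hl : Computable l)
    (hp : Computable fun x : α × β => p x.1 x.2) : Computable fun a => (l a).all (p a) := by
  have : Computable fun a => decide (((l a).filter fun b => !p a b).length ≤ 0) := by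
    fun_prop
  refine this.of_eq fun a => ?_
  rw [Bool.eq_iff_iff]
  simp

@[fun_prop]
theorem computable_range {f : α → ℕ} (hf : Computable f) :
    Computable fun a => List.range (f a) :=
  Primrec.list_range.to_comp.comp hf

theorem computable_decide_nodup [DecidableEq β] {l : α → List β} (hl : Computable l) :
    Computable fun a => decide (l a).Nodup := by
  have : Computable fun x : (α × β) × β => x.1.2 == x.2 := by fun_prop
  have hall : Computable fun a =>
      (l a).all fun b => ((l a).filter fun b' => b' == b).length == 1 :=
    computable_all hl (by fun_prop)
  refine hall.of_eq fun a => Bool.eq_iff_iff.2 ?_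
  simp [List.nodup_iff_count_eq_one, List.count_eq_length_filter]

@[fun_prop]
theorem computable_findGreatest {P : α → ℕ → Prop} [DecidableRel P] {f : α → ℕ}
    (hf : Computable f) (hP : Computable fun x : α × ℕ => decide (P x.1 x.2)) :
    Computable fun a => Nat.findGreatest (P a) (f a) := by
  have hnext : Computable fun x : α × ℕ × ℕ => decide (P x.1 (x.2.1 + 1)) :=
    hP.comp (f := fun x : α × ℕ => decide (P x.1 x.2))
      (g := fun x : α × ℕ × ℕ => (x.1, x.2.1 + 1)) (by fun_prop)
  have hstep : Computable₂ fun (a : α) (x : ℕ × ℕ) =>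
      bif decide (P a (x.1 + 1)) then x.1 + 1 else x.2 := by
    unfold Computable₂
    fun_prop
  refine (Computable.nat_rec hf (Computable.const 0) hstep).of_eq fun a => ?_
  induction f a with
  | zero => simp
  | succ n ih =>
    rw [Nat.findGreatest_succ, ← ih]
    by_cases h : P a (n + 1) <;> simp [h]

end Computability

section REPred

variable {α β : Type*} [Primcodable α] [Primcodable β]

theorem exists_computable_mem_iff {f : α →. β} (hf : Partrec f) :
    ∃ q : (α × β) × ℕ → Bool, Computable q ∧
      ∀ x : α × β, x.2 ∈ f x.1 ↔ ∃ s, q (x, s) = true := by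
  obtain ⟨c, hc⟩ := Nat.Partrec.Code.exists_code.1 hf
  have hev : Computable fun x : (ℕ × Nat.Partrec.Code) × ℕ => x.1.2.evaln x.1.1 x.2 :=
    Nat.Partrec.Code.primrec_evaln.to_comp
  have hstage : Computable fun x : (α × β) × ℕ => c.evaln x.2 (encode x.1.1) :=
    hev.comp (g := fun x : (α × β) × ℕ => ((x.2, c), encode x.1.1)) (by fun_prop)
  refine ⟨fun x => decide (c.evaln x.2 (encode x.1.1) = some (encode x.1.2)),
    computable_decide_eq hstage (by fun_prop), fun x => ?_⟩
  have heval : encode x.2 ∈ c.eval (encode x.1) ↔ x.2 ∈ f x.1 := by simp [hc, encodek]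
  simp only [← heval, Nat.Partrec.Code.evaln_complete, decide_eq_true_eq, Option.mem_def]

theorem rePred_exists_nat {f : α × ℕ → Bool} (hf : Computable f) :
    REPred fun a => ∃ s, f (a, s) = true := by
  have hfind : Partrec fun a => Nat.rfind fun s => Part.some (f (a, s)) :=
    Partrec.rfind (p := fun a s => Part.some (f (a, s))) hf.partrec
  exact hfind.dom_re.of_eq fun a => Nat.rfind_dom.trans <|
    exists_congr fun s => by simp only [Part.mem_some_iff, Part.some_dom, implies_true, and_true,
      eq_comm]

theorem rePred_iff_exists_computable {p : α → Prop} :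
    REPred p ↔ ∃ f : α × ℕ → Bool, Computable f ∧ ∀ a, p a ↔ ∃ s, f (a, s) = true := by
  refine ⟨fun hp => ?_, fun ⟨f, hf, hpf⟩ => (rePred_exists_nat hf).of_eq fun a => (hpf a).symm⟩
  obtain ⟨q, hq, hpq⟩ := exists_computable_mem_iff hp
  refine ⟨fun x => q ((x.1, ()), x.2), by fun_prop, fun a => ?_⟩
  simp [← hpq (a, ())]

theorem rePred_mem {f : α →. β} (hf : Partrec f) : REPred fun x : α × β => x.2 ∈ f x.1 :=
  rePred_iff_exists_computable.2 (exists_computable_mem_iff hf)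

theorem rePred_of_computable {p : α → Prop} [DecidablePred p]
    (hp : Computable fun a => decide (p a)) : REPred p :=
  (Computable.computablePred hp).to_re

theorem rePred_not_of_computable {p : α → Prop} [DecidablePred p]
    (hp : Computable fun a => decide (p a)) : REPred fun a => ¬p a :=
  rePred_of_computable ((computable_not hp).of_eq fun a => by simp)

theorem rePred_comp {p : β → Prop} {f : α → β} (hp : REPred p) (hf : Computable f) :
    REPred fun a => p (f a) :=
  Partrec.comp (f := fun b => Part.assert (p b) fun _ => Part.some ()) hp hf

theorem rePred_and {p q : α → Prop} (hp : REPred p) (hq : REPred q) :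
    REPred fun a => p a ∧ q a := by
  obtain ⟨f, hf, hpf⟩ := rePred_iff_exists_computable.1 hp
  obtain ⟨g, hg, hqg⟩ := rePred_iff_exists_computable.1 hq
  refine rePred_iff_exists_computable.2
    ⟨fun x => f (x.1, x.2.unpair.1) && g (x.1, x.2.unpair.2), by fun_prop, fun a => ?_⟩
  simp only [hpf, hqg, Bool.and_eq_true]
  constructor
  · rintro ⟨⟨s, hs⟩, t, ht⟩
    exact ⟨Nat.pair s t, by simpa using ⟨hs, ht⟩⟩
  · rintro ⟨s, hs, ht⟩
    exact ⟨⟨_, hs⟩, _, ht⟩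

theorem rePred_or {p q : α → Prop} (hp : REPred p) (hq : REPred q) :
    REPred fun a => p a ∨ q a := by
  obtain ⟨k, hk, hkpq⟩ := Partrec.merge hp hq fun _ _ _ _ _ => rfl
  exact hk.dom_re.of_eq fun a => by simp [Part.dom_iff_mem, hkpq]

theorem rePred_exists {p : α → β → Prop} (hp : REPred fun x : α × β => p x.1 x.2) :
    REPred fun a => ∃ b, p a b := by
  obtain ⟨f, hf, hpf⟩ := rePred_iff_exists_computable.1 hp
  refine rePred_iff_exists_computable.2 ⟨fun x => (decode (α := β) x.2.unpair.1).elim false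
    fun b => f ((x.1, b), x.2.unpair.2), by fun_prop, fun a => ⟨?_, ?_⟩⟩
  · rintro ⟨b, hb⟩
    obtain ⟨s, hs⟩ := (hpf (a, b)).1 hb
    exact ⟨Nat.pair (encode b) s, by simpa [encodek] using hs⟩
  · rintro ⟨s, hs⟩
    cases hd : decode (α := β) s.unpair.1 with
    | none => simp [hd] at hs
    | some b => exact ⟨b, (hpf (a, b)).2 ⟨s.unpair.2, by simpa [hd] using hs⟩⟩

end REPred

theorem exists_computable_forall {α : Type*} [Primcodable α] {p : α × ℕ → Bool}
    (hp : Computable p) (hex : ∀ a, ∃ n, p (a, n) = true) :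
    ∃ f : α → ℕ, Computable f ∧ ∀ a, p (a, f a) = true := by
  refine ⟨fun a => Nat.find (hex a), Computable.find ⟨inferInstance, ?_⟩ hex,
    fun a => Nat.find_spec (hex a)⟩
  simpa only [Bool.decide_eq_true] using hp

section Strings

/-- The strings of length `n`, in lexicographic order. -/
def strings : ℕ → List (List Bool)
  | 0 => [[]]
  | n + 1 => (strings n).flatMap fun σ => [σ ++ [false], σ ++ [true]]

@[fun_prop]
theorem computable_strings {α : Type*} [Primcodable α] {f : α → ℕ} (hf : Computable f) :
    Computable fun a => strings (f a) := by
  have hstep : Computable₂ fun (_ : α) (x : ℕ × List (List Bool)) =>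
      x.2.flatMap fun σ => [σ ++ [false], σ ++ [true]] := by
    change Computable fun y : α × ℕ × List (List Bool) =>
      y.2.2.flatMap fun σ => [σ ++ [false], σ ++ [true]]
    fun_prop
  refine (Computable.nat_rec hf (Computable.const [[]]) hstep).of_eq fun a => ?_
  induction f a with
  | zero => rfl
  | succ n ih => simp only [strings, ih]

theorem mem_strings {n : ℕ} {σ : List Bool} : σ ∈ strings n ↔ σ.length = n := by
  induction n generalizing σ with
  | zero => simp [strings]
  | succ n ih =>
    simp only [strings, List.mem_flatMap, ih, List.mem_cons, List.not_mem_nil, or_false]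
    constructor
    · rintro ⟨τ, rfl, rfl | rfl⟩ <;> simp
    · intro hσ
      obtain rfl | ⟨τ, b, rfl⟩ := List.eq_nil_or_concat' σ
      · simp at hσ
      · exact ⟨τ, by simpa using hσ, by cases b <;> simp⟩

theorem length_strings (n : ℕ) : (strings n).length = 2 ^ n := by
  induction n with
  | zero => rfl
  | succ n ih => simp [strings, List.length_flatMap, ih, pow_succ]

theorem nodup_strings (n : ℕ) : (strings n).Nodup := by
  induction n with
  | zero => simp [strings]
  | succ n ih =>
    refine List.nodup_flatMap.2 ⟨by simp, ih.imp fun {σ τ} hne => ?_⟩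
    simp [Function.onFun, hne.symm]

/-- The strings of length `n` as a finite set. -/
def stringsOf (n : ℕ) : Finset (List Bool) := ⟨strings n, nodup_strings n⟩

@[simp]
theorem mem_stringsOf {n : ℕ} {σ : List Bool} : σ ∈ stringsOf n ↔ σ.length = n :=
  mem_strings

theorem card_stringsOf (n : ℕ) : (stringsOf n).card = 2 ^ n :=
  length_strings n

theorem sum_stringsOf_succ {N : Type*} [AddCommMonoid N] (w : List Bool → N) (n : ℕ) :
    ∑ σ ∈ stringsOf (n + 1), w σ =
      ∑ σ ∈ stringsOf n, (w (σ ++ [false]) + w (σ ++ [true])) := by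
  change ((strings (n + 1)).map w).sum =
    ((strings n).map fun σ => w (σ ++ [false]) + w (σ ++ [true])).sum
  rw [strings, List.map_flatMap, List.flatMap_def, List.sum_flatten, List.map_map]
  simp [Function.comp_def]

@[simp]
theorem length_restr (X : ℕ → Bool) (n : ℕ) : (restr X n).length = n := by simp [restr]

theorem getD_restr {X : ℕ → Bool} {n k : ℕ} (h : k < n) : (restr X n).getD k false = X k := by
  simp [restr, h]

theorem restr_succ (X : ℕ → Bool) (n : ℕ) : restr X (n + 1) = restr X n ++ [X n] := by
  simp [restr, List.range_succ]

theorem mem_canonicalTree {C : Set (ℕ → Bool)} {σ : List Bool} :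
    σ ∈ canonicalTree C ↔ ∃ X ∈ C, restr X σ.length = σ :=
  ⟨fun ⟨X, hσ, hX⟩ => ⟨X, hX, hσ⟩, fun ⟨X, hX, hσ⟩ => ⟨X, hσ, hX⟩⟩

theorem mem_canonicalTree_of_append {C : Set (ℕ → Bool)} {σ : List Bool} {b : Bool}
    (h : σ ++ [b] ∈ canonicalTree C) : σ ∈ canonicalTree C := by
  obtain ⟨X, hX, hσ⟩ := mem_canonicalTree.1 h
  rw [List.length_append, List.length_singleton, restr_succ] at hσ
  exact mem_canonicalTree.2 ⟨X, hX, (List.append_inj hσ (by simp)).1⟩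

end Strings

section Dyadic

/-- Addition of dyadic rationals, on the pairs that denote them. -/
def dyadicAdd (p q : ℕ × ℕ) : ℕ × ℕ := (p.1 * 2 ^ q.2 + q.1 * 2 ^ p.2, p.2 + q.2)

/-- Summation of dyadic rationals, on the pairs that denote them. -/
def dyadicSum (l : List (ℕ × ℕ)) : ℕ × ℕ := l.foldl dyadicAdd (0, 0)

theorem dyadic_dyadicAdd (p q : ℕ × ℕ) : dyadic (dyadicAdd p q) = dyadic p + dyadic q := by
  simp only [dyadic, dyadicAdd]
  push_cast
  rw [pow_add]
  field_simp

theorem dyadic_dyadicSum (l : List (ℕ × ℕ)) : dyadic (dyadicSum l) = (l.map dyadic).sum := by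
  rw [List.sum_eq_foldl, List.foldl_map, dyadicSum]
  convert (List.foldl_hom dyadic (g₂ := fun x p => x + dyadic p) (l := l) (init := ((0, 0) : ℕ × ℕ))
    fun x p => (dyadic_dyadicAdd x p).symm).symm
  simp [dyadic]

theorem dyadic_nonneg (p : ℕ × ℕ) : 0 ≤ dyadic p := by
  unfold dyadic
  positivity

theorem dyadic_one (n : ℕ) : dyadic (1, n) = (1 / 2) ^ n := by
  simp [dyadic]

theorem dyadic_lt_dyadic {p q : ℕ × ℕ} :
    dyadic p < dyadic q ↔ p.1 * 2 ^ q.2 < q.1 * 2 ^ p.2 := by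
  rw [dyadic, dyadic, div_lt_div_iff₀ (by positivity) (by positivity)]
  exact_mod_cast Iff.rfl

theorem dyadic_eq_dyadic {p q : ℕ × ℕ} :
    dyadic p = dyadic q ↔ p.1 * 2 ^ q.2 = q.1 * 2 ^ p.2 := by
  rw [dyadic, dyadic, div_eq_div_iff (by positivity) (by positivity)]
  exact_mod_cast Iff.rfl

theorem lt_dyadic_iff {c : ℚ} (hc : 0 ≤ c) {p : ℕ × ℕ} :
    c < dyadic p ↔ c.num.natAbs * 2 ^ p.2 < p.1 * c.den := by
  have hnum : (c.num.natAbs : ℚ) = c.num := by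
    rw [Nat.cast_natAbs, abs_of_nonneg (Rat.num_nonneg.2 hc)]
  have hden : (0 : ℚ) < c.den := by exact_mod_cast c.den_pos
  have hc : c = c.num.natAbs / c.den := by rw [hnum, Rat.num_div_den]
  have hdiv : (c.num.natAbs / c.den : ℚ) < dyadic p ↔ c.num.natAbs * 2 ^ p.2 < p.1 * c.den := by
    rw [dyadic, div_lt_div_iff₀ hden (by positivity)]
    exact_mod_cast Iff.rfl
  rwa [← hc] at hdiv

variable {α : Type*} [Primcodable α] {p q : α → ℕ × ℕ}

@[fun_prop]
theorem computable_dyadicAdd (hp : Computable p) (hq : Computable q) :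
    Computable fun a => dyadicAdd (p a) (q a) := by
  unfold dyadicAdd
  fun_prop

@[fun_prop]
theorem computable_dyadicSum {l : α → List (ℕ × ℕ)} (hl : Computable l) :
    Computable fun a => dyadicSum (l a) := by
  unfold dyadicSum
  fun_prop

theorem computable_dyadic_lt (hp : Computable p) (hq : Computable q) :
    Computable fun a => decide (dyadic (p a) < dyadic (q a)) := by
  simp only [dyadic_lt_dyadic]
  fun_prop

theorem computable_dyadic_eq (hp : Computable p) (hq : Computable q) :
    Computable fun a => decide (dyadic (p a) = dyadic (q a)) := by
  simp only [dyadic_eq_dyadic]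
  exact computable_decide_eq (by fun_prop) (by fun_prop)

theorem computable_lt_dyadic {c : ℚ} (hc : 0 ≤ c) (hp : Computable p) :
    Computable fun a => decide (c < dyadic (p a)) := by
  simp only [lt_dyadic_iff hc]
  fun_prop

end Dyadic

section EffectivelyClosed

theorem IsPi01.inter {C C' : Set (ℕ → Bool)} (hC : IsPi01 C) (hC' : IsPi01 C') :
    IsPi01 (C ∩ C') := by
  obtain ⟨S, hS, rfl⟩ := hC
  obtain ⟨S', hS', rfl⟩ := hC'
  exact ⟨S ∪ S', rePred_or hS hS', by rw [Set.biUnion_union, Set.compl_union]⟩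

theorem getElem?_restr (X : ℕ → Bool) {n k : ℕ} (h : k < n) : (restr X n)[k]? = some (X k) := by
  simp [restr, h]

variable {β : Type*} [Primcodable β]

theorem isPi01_setOf_forall {q : β → List ℕ} {P : β → List Bool → Prop} (hq : Computable q)
    (hP : REPred fun x : β × List Bool => ¬P x.1 x.2) :
    IsPi01 {X | ∀ b, P b ((q b).map X)} := by
  let answers (σ : List Bool) (b : β) : List Bool := (q b).map fun n => σ[n]? == some true
  have hrestr : ∀ X n b, (∀ k ∈ q b, k < n) → answers (restr X n) b = (q b).map X :=
    fun X n b hn => List.map_congr_left fun k hk => by simp [getElem?_restr X (hn k hk)]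
  refine ⟨{σ | ∃ b, ((q b).all fun n => decide (n < σ.length)) ∧ ¬P b (answers σ b)}, ?_, ?_⟩
  · refine rePred_exists (p := fun σ b => ((q b).all fun n => decide (n < σ.length)) ∧
      ¬P b (answers σ b)) (rePred_and (rePred_of_computable ?_) ?_)
    · simp only [Bool.decide_eq_true]
      fun_prop
    · have hanswers : Computable fun x : List Bool × β => (x.2, answers x.1 x.2) := by fun_prop
      exact rePred_comp (p := fun x : β × List Bool => ¬P x.1 x.2) hP hanswers
  · ext X
    simp only [Set.mem_ofPred_eq, Set.mem_compl_iff, Set.mem_iUnion, not_exists, cylinder,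
      List.all_eq_true, decide_eq_true_eq]
    constructor
    · rintro hX σ ⟨b, hb, hPb⟩ hσ
      rw [← hσ] at hb hPb
      rw [hrestr X _ b (by simpa using hb)] at hPb
      exact hPb (hX b)
    · intro hX b
      by_contra hPb
      have hlt : ∀ k ∈ q b, k < (q b).sum + 1 := fun k hk =>
        Nat.lt_succ_of_le (List.le_sum_of_mem hk)
      exact hX (restr X ((q b).sum + 1))
        ⟨b, by simpa using hlt, by rwa [hrestr X _ b hlt]⟩ (by simp)

variable {α : Type} [Primcodable α]

theorem charSeq_encode {A : Set α} {a : α} : charSeq A (encode a) = true ↔ a ∈ A := by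
  simp [charSeq]

theorem charSeq_injective : Function.Injective (charSeq (α := α)) := fun A B h =>
  Set.ext fun a => by rw [← charSeq_encode, h, charSeq_encode]

theorem range_charSeq :
    Set.range (charSeq (α := α)) = {X | ∀ n, X n = true → (decode₂ α n).isSome} := by
  ext X
  constructor
  · rintro ⟨A, rfl⟩ n hn
    obtain ⟨a, -, rfl⟩ : ∃ a ∈ A, encode a = n := by simpa [charSeq] using hn
    simp
  · refine fun hX => ⟨{a | X (encode a) = true}, funext fun n => Bool.eq_iff_iff.2 ?_⟩
    simp only [charSeq, decide_eq_true_eq, Set.mem_ofPred_eq]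
    refine ⟨fun ⟨_, ha, hn⟩ => hn ▸ ha, fun hn => ?_⟩
    obtain ⟨a, ha⟩ := Option.isSome_iff_exists.1 (hX n hn)
    exact ⟨a, by rwa [mem_decode₂.1 ha], mem_decode₂.1 ha⟩

theorem isPi01_range_charSeq : IsPi01 (Set.range (charSeq (α := α))) := by
  have hPi : IsPi01 {X | ∀ n, [n].map X = [true] → (decode₂ α n).isSome = true} := by
    refine isPi01_setOf_forall (q := fun n => [n])
      (P := fun n l => l = [true] → (decode₂ α n).isSome = true) (by fun_prop) ?_
    simp only [Classical.not_imp]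
    have hsome : Computable fun n : ℕ => (decode₂ α n).isSome :=
      Primrec.option_isSome.to_comp.comp Primrec.decode₂.to_comp
    refine rePred_and (rePred_of_computable (computable_decide_eq (by fun_prop) (by fun_prop)))
      (rePred_of_computable ?_)
    simp only [Bool.not_eq_true, ← Bool.not_eq_true', Bool.decide_eq_true]
    exact computable_not (hsome.comp Computable.fst)
  simpa [range_charSeq] using hPi

theorem isPi01_charSeq_image_inter {𝒜 ℬ : Set (Set α)} (h𝒜 : IsPi01 (charSeq '' 𝒜))
    (hℬ : IsPi01 (charSeq '' ℬ)) : IsPi01 (charSeq '' (𝒜 ∩ ℬ)) := by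
  rw [Set.image_inter charSeq_injective]
  exact h𝒜.inter hℬ

open Classical in
theorem isPi01_charSeq_image {q : β → List α} {P : β → List Bool → Prop} (hq : Computable q)
    (hP : REPred fun x : β × List Bool => ¬P x.1 x.2) :
    IsPi01 (charSeq '' {A : Set α | ∀ b, P b ((q b).map fun a => decide (a ∈ A))}) := by
  have hqueries : ∀ A b, ((q b).map encode).map (charSeq A) = (q b).map fun a => decide (a ∈ A) :=
    fun A b => by
      rw [List.map_map]
      exact List.map_congr_left fun a _ => Bool.eq_iff_iff.2 (by simp [charSeq_encode])
  have himage : charSeq '' {A : Set α | ∀ b, P b ((q b).map fun a => decide (a ∈ A))} =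
      Set.range (charSeq (α := α)) ∩ {X | ∀ b : β, P b (((q b).map encode).map X)} := by
    rw [← Set.image_preimage_eq_range_inter]
    simp only [Set.preimage_ofPred_eq, hqueries]
  rw [himage]
  exact isPi01_range_charSeq.inter
    (isPi01_setOf_forall (q := fun b => (q b).map encode) (by fun_prop) hP)

theorem isPi01_charSeq_image_clause {q q' : β → List α} {P : β → Prop} (hq : Computable q)
    (hq' : Computable q') (hP : REPred fun b => ¬P b) :
    IsPi01 (charSeq '' {A : Set α |
      ∀ b, (∀ a ∈ q b, a ∈ A) → P b ∨ ∃ a ∈ q' b, a ∈ A}) := by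
  classical
  have hPi := isPi01_charSeq_image (β := β) (q := fun b => q b ++ q' b)
    (P := fun (b : β) l => l = ((q b).map fun _ => true) ++ ((q' b).map fun _ => false) → P b)
    (computable_append hq hq') ?_
  · convert hPi using 4 with A
    refine forall_congr' fun b => ?_
    have hl : (q b ++ q' b).map (fun a => decide (a ∈ A)) =
        ((q b).map fun _ => true) ++ ((q' b).map fun _ => false) ↔
          (∀ a ∈ q b, a ∈ A) ∧ ∀ a ∈ q' b, a ∉ A := by
      rw [List.map_append]
      refine ⟨fun h => ?_, fun ⟨h, h'⟩ => ?_⟩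
      · obtain ⟨h, h'⟩ := List.append_inj h (by simp)
        exact ⟨by simpa using List.map_inj_left.1 h, by simpa using List.map_inj_left.1 h'⟩
      · congr 1 <;> exact List.map_congr_left (by simpa)
    rw [hl]
    grind
  · simp only [Classical.not_imp]
    exact rePred_and (rePred_of_computable (computable_decide_eq (by fun_prop) (by fun_prop)))
      (rePred_comp (p := fun b => ¬P b) hP Computable.fst)

end EffectivelyClosed

section Complexity

theorem complexity_le {U : List Bool →. List Bool} {σ τ : List Bool} (h : σ ∈ U τ) :
    complexity U σ ≤ τ.length :=
  Nat.sInf_le ⟨τ, rfl, h⟩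

section ParametrizedMachine

variable {Φ : ℕ × List Bool →. List Bool} {L : ℕ → ℕ}

/-- The machine that reads a program `1ᵐ0τ` with `τ.length = L m` and outputs `Φ (m, τ)`; it
diverges on strings that are not of this form. Its domain is prefix-free because `m` can be read
off and determines the length of the program. -/
def parametrizedMachine (Φ : ℕ × List Bool →. List Bool) (L : ℕ → ℕ) : List Bool →. List Bool :=
  fun x => bif x.length == x.idxOf false + 1 + L (x.idxOf false) then
    Φ (x.idxOf false, x.drop (x.idxOf false + 1)) else Part.none

theorem length_eq_of_parametrizedMachine_dom {x : List Bool}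
    (hx : (parametrizedMachine Φ L x).Dom) :
    x.length = x.idxOf false + 1 + L (x.idxOf false) := by
  by_contra hne
  simp only [parametrizedMachine, beq_false_of_ne hne] at hx
  exact hx

theorem isPrefixFreeMachine_parametrizedMachine (hΦ : Partrec Φ) (hL : Computable L) :
    IsPrefixFreeMachine (parametrizedMachine Φ L) where
  partrec := by
    refine Partrec.cond (by fun_prop) (hΦ.comp ?_) Partrec.none
    fun_prop
  prefixFree := by
    rintro x _ hx hy ⟨t, rfl⟩
    have hxlen := length_eq_of_parametrizedMachine_dom hx
    have hylen := length_eq_of_parametrizedMachine_dom hy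
    have hmem : false ∈ x := List.idxOf_lt_length_iff.1 (by lia)
    rw [List.idxOf_append_of_mem hmem, List.length_append] at hylen
    have ht : t = [] := List.length_eq_zero_iff.1 (by lia)
    simp [ht]

theorem parametrizedMachine_program {m : ℕ} {τ : List Bool} (hτ : τ.length = L m) :
    parametrizedMachine Φ L (List.replicate m true ++ false :: τ) = Φ (m, τ) := by
  have hidx : (List.replicate m true ++ false :: τ).idxOf false = m := by
    rw [List.idxOf_append_of_notMem (by simp [List.mem_replicate])]
    simp
  have hdrop : (List.replicate m true ++ false :: τ).drop (m + 1) = τ := by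
    simp [List.drop_append]
  have hlen : (List.replicate m true ++ false :: τ).length = m + 1 + L m := by
    simp [hτ]
    lia
  simp only [parametrizedMachine, hidx, hdrop, hlen, beq_self_eq_true, cond_true]

end ParametrizedMachine

namespace IsUniversalMachine

variable {U : List Bool →. List Bool}

theorem exists_program_length_le (hU : IsUniversalMachine U) {Φ : ℕ × List Bool →. List Bool}
    (hΦ : Partrec Φ) {L : ℕ → ℕ} (hL : Computable L) :
    ∃ c : ℕ, ∀ m τ σ, τ.length = L m → σ ∈ Φ (m, τ) →
      ∃ τ', σ ∈ U τ' ∧ τ'.length ≤ m + 1 + L m + c := by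
  obtain ⟨c, hc⟩ := hU.optimal _ (isPrefixFreeMachine_parametrizedMachine hΦ hL)
  refine ⟨c, fun m τ σ hτ hσ => ?_⟩
  obtain ⟨τ', hτ', hlen⟩ := hc (List.replicate m true ++ false :: τ) σ
    (by rwa [parametrizedMachine_program hτ])
  refine ⟨τ', hτ', hlen.trans_eq ?_⟩
  simp only [List.length_append, List.length_replicate, List.length_cons, hτ]
  lia

theorem exists_const_program_length_le (hU : IsUniversalMachine U) :
    ∃ c : ℕ, ∀ σ, ∃ τ, σ ∈ U τ ∧ τ.length ≤ 2 * σ.length + 1 + c := by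
  have hsnd : Partrec fun x : ℕ × List Bool => Part.some x.2 := Computable.snd.partrec
  obtain ⟨c, hc⟩ := hU.exists_program_length_le hsnd (L := fun m => m) Computable.id
  refine ⟨c, fun σ => ?_⟩
  obtain ⟨τ, hτ, hlen⟩ := hc σ.length σ σ rfl (Part.mem_some _)
  exact ⟨τ, hτ, by lia⟩

theorem exists_computable_complexity_lt (hU : IsUniversalMachine U) :
    ∃ B : List Bool → ℕ, Computable B ∧ ∀ σ, complexity U σ < B σ := by
  obtain ⟨c, hc⟩ := hU.exists_const_program_length_le
  refine ⟨fun σ => 2 * σ.length + (c + 2), by fun_prop, fun σ => ?_⟩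
  obtain ⟨τ, hτ, hlen⟩ := hc σ
  exact (complexity_le hτ).trans_lt (by lia)

theorem complexity_lt_iff (hU : IsUniversalMachine U) {σ : List Bool} {k : ℕ} :
    complexity U σ < k ↔ ∃ τ, τ.length < k ∧ σ ∈ U τ := by
  refine ⟨fun hσ => ?_, fun ⟨τ, hτ, hσ⟩ => (complexity_le hσ).trans_lt hτ⟩
  obtain ⟨c, hc⟩ := hU.exists_const_program_length_le
  obtain ⟨τ, hτ, -⟩ := hc σ
  obtain ⟨τ, hlen, hτ⟩ : complexity U σ ∈ {n | ∃ τ : List Bool, τ.length = n ∧ σ ∈ U τ} :=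
    Nat.sInf_mem ⟨τ.length, τ, rfl, hτ⟩
  exact ⟨τ, hlen.trans_lt hσ, hτ⟩

theorem rePred_complexity_lt (hU : IsUniversalMachine U) :
    REPred fun x : List Bool × ℕ => complexity U x.1 < x.2 := by
  simp only [hU.complexity_lt_iff]
  refine rePred_exists (p := fun (x : List Bool × ℕ) τ => τ.length < x.2 ∧ x.1 ∈ U τ)
    (rePred_and (rePred_of_computable (by fun_prop)) ?_)
  exact rePred_comp (f := fun y : (List Bool × ℕ) × List Bool => (y.2, y.1.1))
    (rePred_mem hU.machine.partrec) (by fun_prop)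

theorem exists_complexity_le_of_enumeration (hU : IsUniversalMachine U) {L : ℕ → ℕ}
    (hL : Computable L) {A : ℕ → ℕ → List (List Bool)} (hA : Computable₂ A)
    (hprefix : ∀ m i j, i ≤ j → A m i <+: A m j) (hlength : ∀ m i, (A m i).length ≤ 2 ^ L m) :
    ∃ c : ℕ, ∀ m i, ∀ σ ∈ A m i, complexity U σ ≤ m + 1 + L m + c := by
  let Φ : ℕ × List Bool →. List Bool := fun x =>
    Nat.rfindOpt fun i => (A x.1 i)[(strings (L x.1)).idxOf x.2]?
  have hΦ : Partrec Φ := by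
    refine Partrec.rfindOpt (f := fun (x : ℕ × List Bool) i =>
      (A x.1 i)[(strings (L x.1)).idxOf x.2]?) ?_
    have hstage : Computable fun y : (ℕ × List Bool) × ℕ => A y.1.1 y.2 :=
      Computable.comp (f := fun x : ℕ × ℕ => A x.1 x.2) hA
        (g := fun y : (ℕ × List Bool) × ℕ => (y.1.1, y.2)) (by fun_prop)
    exact computable_getElem? hstage (by fun_prop)
  obtain ⟨c, hc⟩ := hU.exists_program_length_le hΦ hL
  refine ⟨c, fun m i σ hσ => ?_⟩
  obtain ⟨t, ht, rfl⟩ := List.getElem_of_mem hσ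
  have htL : t < (strings (L m)).length := by
    rw [length_strings]
    exact ht.trans_le (hlength m i)
  have houtput : (A m i)[t] ∈ Φ (m, (strings (L m))[t]) := by
    simp only [Φ, (nodup_strings (L m)).idxOf_getElem t htL]
    refine (Nat.rfindOpt_mono fun {ρ j k} hjk hj => ?_).2 ⟨i, List.getElem?_eq_getElem ht⟩
    obtain ⟨ht, hρ⟩ := List.getElem?_eq_some_iff.1 hj
    exact List.getElem?_eq_some_iff.2
      ⟨ht.trans_le (hprefix m j k hjk).length_le, ((hprefix m j k hjk).getElem ht).symm.trans hρ⟩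
  obtain ⟨τ, hτ, hlen⟩ := hc m _ _ (mem_strings.1 (List.getElem_mem htL)) houtput
  exact (complexity_le hτ).trans hlen

end IsUniversalMachine

end Complexity

section TreeWeight

open Classical in
/-- The weight that `M` gives to the `n`-th level of the canonical tree of `C`, written as a finite
sum. -/
noncomputable def treeWeight (M : List Bool → ℝ) (C : Set (ℕ → Bool)) (n : ℕ) : ℝ :=
  ∑ σ ∈ stringsOf n with σ ∈ canonicalTree C, M σ

theorem tsum_level (M : List Bool → ℝ) (C : Set (ℕ → Bool)) (n : ℕ) :
    ∑' σ : level (canonicalTree C) n, M σ = treeWeight M C n := by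
  classical
  have hlevel : level (canonicalTree C) n =
      ({σ ∈ stringsOf n | σ ∈ canonicalTree C} : Finset (List Bool)) := by
    ext σ
    simp [level, mem_stringsOf, and_comm]
  rw [hlevel, Finset.tsum_subtype' _ M, treeWeight]

namespace IsSemimeasure

variable {M : List Bool → ℝ}

theorem sum_stringsOf_le_one (hM : IsSemimeasure M) (n : ℕ) : ∑ σ ∈ stringsOf n, M σ ≤ 1 := by
  induction n with
  | zero => simp [stringsOf, strings, hM.root]
  | succ n ih =>
    rw [sum_stringsOf_succ]
    exact (Finset.sum_le_sum fun σ _ => hM.split σ).trans ih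

theorem treeWeight_antitone (hM : IsSemimeasure M) (C : Set (ℕ → Bool)) :
    Antitone (treeWeight M C) := by
  refine antitone_nat_of_succ_le fun n => ?_
  rw [treeWeight, treeWeight, Finset.sum_filter, Finset.sum_filter, sum_stringsOf_succ]
  refine Finset.sum_le_sum fun σ _ => ?_
  by_cases hσ : σ ∈ canonicalTree C
  · rw [if_pos hσ]
    refine le_trans ?_ (hM.split σ)
    gcongr <;> split_ifs <;> first | exact le_rfl | exact hM.nonneg _
  · have hchild : ∀ b, σ ++ [b] ∉ canonicalTree C := fun b hb =>
      hσ (mem_canonicalTree_of_append hb)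
    simp [hσ, hchild]

theorem treeWeight_le_one (hM : IsSemimeasure M) (C : Set (ℕ → Bool)) (n : ℕ) :
    treeWeight M C n ≤ 1 := by
  classical
  exact (Finset.sum_le_sum_of_subset_of_nonneg (Finset.filter_subset _ _) fun σ _ _ =>
    hM.nonneg σ).trans (hM.sum_stringsOf_le_one n)

theorem isDeep_of_treeWeight_le (hM : IsSemimeasure M) {C : Set (ℕ → Bool)} (hC : IsPi01 C)
    {N : ℕ → ℕ} (hN : Computable N) (c : ℕ)
    (hle : ∀ m, c ≤ m → treeWeight M C (N m) ≤ (1 / 2) ^ m) : IsDeep M C := by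
  refine ⟨hC, fun n => Nat.findGreatest (fun m => c ≤ m ∧ N m ≤ n) n, ⟨?_, ?_, ?_⟩, fun n => ?_⟩
  · refine computable_findGreatest (P := fun n m => c ≤ m ∧ N m ≤ n) (by fun_prop) ?_
    simp only [Bool.decide_and]
    fun_prop
  · exact fun n n' hn => Nat.findGreatest_mono (fun m hm => ⟨hm.1, hm.2.trans hn⟩) hn
  · refine fun k => ⟨max (max k c) (N (max k c)), (le_max_left k c).trans ?_⟩
    exact Nat.le_findGreatest (le_max_left _ _) ⟨le_max_right _ _, le_max_right _ _⟩
  · rw [tsum_level]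
    beta_reduce
    by_cases hzero : Nat.findGreatest (fun m => c ≤ m ∧ N m ≤ n) n = 0
    · rw [hzero, pow_zero]
      exact hM.treeWeight_le_one C n
    · obtain ⟨hc, hNn⟩ := Nat.findGreatest_of_ne_zero rfl hzero
      exact (hM.treeWeight_antitone C hNn).trans (hle _ hc)

end IsSemimeasure

end TreeWeight

section Greedy

variable {β : Type*}

/-- A list is greedy for `P` if each of its entries satisfies `P` relative to the list of the
entries before it. -/
def IsGreedy (P : List β → β → Prop) (l : List β) : Prop :=
  ∀ l₁ b, l₁ ++ [b] <+: l → P l₁ b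

theorem isGreedy_nil (P : List β → β → Prop) : IsGreedy P [] := by
  simp [IsGreedy]

theorem isGreedy_append_singleton {P : List β → β → Prop} {l : List β} {b : β} :
    IsGreedy P (l ++ [b]) ↔ IsGreedy P l ∧ P l b := by
  constructor
  · exact fun h => ⟨fun l₁ b₁ hl₁ => h l₁ b₁ (hl₁.trans (List.prefix_append _ _)),
      h l b List.prefix_rfl⟩
  · rintro ⟨hl, hb⟩ l₁ b₁ hl₁
    rcases List.prefix_concat_iff.1 hl₁ with heq | hl₁
    · obtain ⟨rfl, hb₁⟩ := List.append_inj' heq rfl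
      obtain rfl := List.singleton_inj.1 hb₁
      exact hb
    · exact hl l₁ b₁ hl₁

theorem IsGreedy.forall_mem {P : List β → β → Prop} {Q : β → Prop} {l : List β}
    (hl : IsGreedy P l) (hPQ : ∀ l₁ b, P l₁ b → Q b) : ∀ b ∈ l, Q b := by
  intro b hb
  obtain ⟨l₁, l₂, rfl⟩ := List.append_of_mem hb
  exact hPQ l₁ b (hl l₁ b ⟨l₂, by simp⟩)

variable [Primcodable β]

/-- The greedy list that is found in `i` steps, where `f ((l, b), s)` says that at stage `s` the
entry `b` is seen to be admissible after the entries `l`. The third component of the step number is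
idle; it makes every test recur at arbitrarily late steps. -/
def greedyStage (f : (List β × β) × ℕ → Bool) : ℕ → List β
  | 0 => []
  | i + 1 => (decode (α := β × ℕ × ℕ) i).elim (greedyStage f i) fun x =>
      bif f ((greedyStage f i, x.1), x.2.1) then greedyStage f i ++ [x.1] else greedyStage f i

section GreedyStage

variable {f : (List β × β) × ℕ → Bool}

theorem greedyStage_succ (f : (List β × β) × ℕ → Bool) (i : ℕ) :
    greedyStage f (i + 1) = greedyStage f i ∨ ∃ b s, f ((greedyStage f i, b), s) = true ∧
      greedyStage f (i + 1) = greedyStage f i ++ [b] := by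
  rw [greedyStage]
  cases decode (α := β × ℕ × ℕ) i with
  | none => exact Or.inl rfl
  | some x =>
    cases h : f ((greedyStage f i, x.1), x.2.1) with
    | false => exact Or.inl (by simp [h])
    | true => exact Or.inr ⟨x.1, x.2.1, h, by simp [h]⟩

theorem greedyStage_prefix (f : (List β × β) × ℕ → Bool) {i j : ℕ} (hij : i ≤ j) :
    greedyStage f i <+: greedyStage f j := by
  induction j, hij using Nat.le_induction with
  | base => exact List.prefix_rfl
  | succ j _ ih =>
    rcases greedyStage_succ f j with heq | ⟨b, s, -, heq⟩
    · rwa [heq]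
    · exact heq ▸ ih.trans (List.prefix_append _ _)

theorem isGreedy_greedyStage {P : List β → β → Prop} (hf : ∀ l b s, f ((l, b), s) = true → P l b)
    (i : ℕ) : IsGreedy P (greedyStage f i) := by
  induction i with
  | zero => exact isGreedy_nil P
  | succ i ih =>
    rcases greedyStage_succ f i with heq | ⟨b, s, hb, heq⟩
    · rwa [heq]
    · exact heq ▸ isGreedy_append_singleton.2 ⟨ih, hf _ _ _ hb⟩

theorem computable_greedyStage {γ : Type*} [Primcodable γ] {f : γ → (List β × β) × ℕ → Bool}
    (hf : Computable fun x : γ × (List β × β) × ℕ => f x.1 x.2) :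
    Computable₂ fun c => greedyStage (f c) := by
  have : Computable fun x : ((γ × ℕ) × ℕ × List β) × β × ℕ × ℕ =>
      f x.1.1.1 ((x.1.2.2, x.2.1), x.2.2.1) :=
    hf.comp (g := fun x : ((γ × ℕ) × ℕ × List β) × β × ℕ × ℕ =>
      (x.1.1.1, (x.1.2.2, x.2.1), x.2.2.1)) (by fun_prop)
  have hstep : Computable₂ fun (x : γ × ℕ) (y : ℕ × List β) =>
      (decode (α := β × ℕ × ℕ) y.1).elim y.2 fun z =>
        bif f x.1 ((y.2, z.1), z.2.1) then y.2 ++ [z.1] else y.2 :=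
    computable_optionElim (by fun_prop) (by fun_prop) (by fun_prop)
  refine (Computable.nat_rec Computable.snd (Computable.const []) hstep).of_eq fun x => ?_
  induction x.2 with
  | zero => rfl
  | succ i ih => simp only [greedyStage, ih]

theorem exists_greedyStage_maximal {k : ℕ} (hk : ∀ i, (greedyStage f i).length ≤ k) :
    ∃ i, ∀ b s, f ((greedyStage f i, b), s) = false := by
  obtain ⟨i, hi⟩ : ∃ i, ∀ j, (greedyStage f j).length ≤ (greedyStage f i).length := by
    refine ⟨Function.argmin fun i => k - (greedyStage f i).length, fun j => ?_⟩
    have hle := Function.argmin_le (fun i => k - (greedyStage f i).length) j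
    have := hk j
    lia
  have hconst : ∀ j, i ≤ j → greedyStage f j = greedyStage f i := fun j hij =>
    ((greedyStage_prefix f hij).eq_of_length_le (hi j)).symm
  refine ⟨i, fun b s => ?_⟩
  have hij : i ≤ encode (b, s, i) :=
    (Nat.right_le_pair s i).trans (Nat.right_le_pair (encode b) (Nat.pair s i))
  have hsucc := hconst _ (hij.trans (Nat.le_succ _))
  rw [greedyStage, encodek, Option.elim_some, hconst _ hij] at hsucc
  by_contra hb
  simp [eq_true_of_ne_false hb] at hsucc

end GreedyStage

theorem exists_computable_greedy {γ : Type*} [Primcodable γ] {P : γ → List β → β → Prop}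
    (hP : REPred fun x : γ × List β × β => P x.1 x.2.1 x.2.2) :
    ∃ A : γ → ℕ → List β, Computable₂ A ∧ (∀ c i, IsGreedy (P c) (A c i)) ∧
      (∀ c i j, i ≤ j → A c i <+: A c j) ∧
      ∀ c k, (∀ i, (A c i).length ≤ k) → ∃ i, ∀ b, ¬P c (A c i) b := by
  obtain ⟨f, hf, hPf⟩ := rePred_iff_exists_computable.1 hP
  replace hPf : ∀ c l b, P c l b ↔ ∃ s, f ((c, l, b), s) = true := fun c l b => hPf (c, l, b)
  refine ⟨fun c => greedyStage fun y => f ((c, y.1), y.2), ?_, fun c i => ?_, fun c i j =>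
    greedyStage_prefix _, fun c k hk => ?_⟩
  · exact computable_greedyStage (f := fun c y => f ((c, y.1), y.2)) (by fun_prop)
  · exact isGreedy_greedyStage (fun l b s h => (hPf c l b).2 ⟨s, h⟩) i
  · obtain ⟨i, hi⟩ := exists_greedyStage_maximal hk
    exact ⟨i, fun b hb => by simpa [hi b] using (hPf c _ b).1 hb⟩

end Greedy

section Counting

variable {β ι : Type*} {r : β → ι → Bool} {s : Finset ι} {w : ι → ℝ}

/-- The elements of `s` that are related to `b` and to no entry of `l`. -/
def fresh (r : β → ι → Bool) (s : Finset ι) (l : List β) (b : β) : Finset ι :=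
  {x ∈ s | r b x && l.all fun b' => !r b' x}

theorem IsGreedy.length_mul_le_sum {ε : ℝ} {l : List β} (hw : ∀ x ∈ s, 0 ≤ w x)
    (hl : IsGreedy (fun l b => ε ≤ ∑ x ∈ fresh r s l b, w x) l) :
    l.length * ε ≤ ∑ x ∈ s, w x := by
  classical
  suffices l.length * ε ≤ ∑ x ∈ s with ∃ b ∈ l, r b x, w x from
    this.trans (Finset.sum_le_sum_of_subset_of_nonneg (Finset.filter_subset _ _) fun x hx _ =>
      hw x hx)
  induction l using List.reverseRecOn with
  | nil => simp
  | append_singleton l b ih =>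
    obtain ⟨hl, hb⟩ := isGreedy_append_singleton.1 hl
    have hdisj : Disjoint {x ∈ s | ∃ b ∈ l, r b x} (fresh r s l b) :=
      Finset.disjoint_left.2 fun x => by
        simp only [fresh, Finset.mem_filter, Bool.and_eq_true, List.all_eq_true,
          Bool.not_eq_true']
        grind
    have hunion : {x ∈ s | ∃ b' ∈ l ++ [b], r b' x} =
        {x ∈ s | ∃ b ∈ l, r b x} ∪ fresh r s l b := by
      ext x
      simp only [fresh, Finset.mem_union, Finset.mem_filter, Bool.and_eq_true, List.all_eq_true,
        Bool.not_eq_true']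
      grind
    rw [hunion, Finset.sum_union hdisj, List.length_append, List.length_singleton]
    push_cast
    linarith [ih hl]

theorem mul_sum_le_card_mul_of_forall_sum_le {t : Finset β} {n ε : ℝ} (hw : ∀ x ∈ s, 0 ≤ w x)
    (hn : ∀ x ∈ s, n ≤ ({b ∈ t | r b x} : Finset β).card)
    (hε : ∀ b ∈ t, ∑ x ∈ s with r b x, w x ≤ ε) : n * ∑ x ∈ s, w x ≤ t.card * ε :=
  calc n * ∑ x ∈ s, w x = ∑ x ∈ s, n * w x := Finset.mul_sum ..
    _ ≤ ∑ x ∈ s, ∑ b ∈ t with r b x, w x := by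
      refine Finset.sum_le_sum fun x hx => ?_
      rw [Finset.sum_const, nsmul_eq_mul]
      exact mul_le_mul_of_nonneg_right (hn x hx) (hw x hx)
    _ = ∑ b ∈ t, ∑ x ∈ s with r b x, w x := Finset.sum_comm' (by grind)
    _ ≤ t.card * ε := by
      rw [← nsmul_eq_mul]
      exact Finset.sum_le_card_nsmul _ _ _ hε

end Counting

section ComplexStrings

variable {U : List Bool →. List Bool} {M : List Bool → ℝ} {C : Set (ℕ → Bool)}

theorem LowerSemicomputable.rePred_lt_sum (hM : LowerSemicomputable M) :
    REPred fun x : ℕ × List (List Bool) => (1 / 2) ^ x.1 < (x.2.map M).sum := by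
  obtain ⟨a, ha, hmono, hlim⟩ := hM
  replace ha : Computable fun x : List Bool × ℕ => a x.1 x.2 := ha
  have hle : ∀ σ s, ((dyadic (a σ s) : ℚ) : ℝ) ≤ M σ := fun σ s =>
    Monotone.ge_of_tendsto (fun i j hij => Rat.cast_le.2 (hmono σ hij)) (hlim σ) s
  let approx (l : List (List Bool)) (s : ℕ) : ℕ × ℕ := dyadicSum (l.map fun σ => a σ s)
  have happrox : ∀ l s, ((dyadic (approx l s) : ℚ) : ℝ) =
      (l.map fun σ => ((dyadic (a σ s) : ℚ) : ℝ)).sum := by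
    intro l s
    rw [dyadic_dyadicSum, Rat.cast_list_sum, List.map_map, List.map_map]
    rfl
  have hcast : ∀ k p, (1 / 2 : ℝ) ^ k < ((dyadic p : ℚ) : ℝ) ↔ dyadic (1, k) < dyadic p := by
    intro k p
    rw [dyadic_one, ← Rat.cast_lt (K := ℝ)]
    push_cast
    rfl
  refine rePred_iff_exists_computable.2
    ⟨fun y => decide (dyadic (1, y.1.1) < dyadic (approx y.1.2 y.2)), ?_, fun ⟨k, l⟩ => ?_⟩
  · have : Computable fun x : ((ℕ × List (List Bool)) × ℕ) × List Bool => a x.2 x.1.2 :=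
      ha.comp (g := fun x : ((ℕ × List (List Bool)) × ℕ) × List Bool => (x.2, x.1.2))
        (by fun_prop)
    exact computable_dyadic_lt (by fun_prop) (computable_dyadicSum (by fun_prop))
  · simp only [decide_eq_true_eq, ← hcast, happrox]
    constructor
    · have hsum : Tendsto (fun s => (l.map fun σ => ((dyadic (a σ s) : ℚ) : ℝ)).sum) atTop
          (𝓝 (l.map M).sum) := tendsto_list_sum l fun σ _ => hlim σ
      exact fun hlt => (hsum.eventually_const_lt hlt).exists
    · rintro ⟨s, hs⟩
      exact hs.trans_le (List.sum_le_sum fun σ _ => hle σ s)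

section Covering

variable {N ℓ L : ℕ → ℕ} {r : ℕ → List Bool → List Bool → Bool}

theorem LowerSemicomputable.rePred_lt_sum_fresh (hM : LowerSemicomputable M) (hN : Computable N)
    (hℓ : Computable ℓ) (hL : Computable L)
    (hr : Computable fun x : ℕ × List Bool × List Bool => r x.1 x.2.1 x.2.2) :
    REPred fun x : ℕ × List (List Bool) × List Bool => x.2.2.length = ℓ x.1 ∧
      (1 / 2) ^ L x.1 < ∑ τ ∈ fresh (r x.1) (stringsOf (N x.1)) x.2.1 x.2.2, M τ := by
  have hrelated : Computable fun y : (ℕ × List (List Bool) × List Bool) × List Bool =>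
      r y.1.1 y.1.2.2 y.2 :=
    hr.comp (g := fun y : (ℕ × List (List Bool) × List Bool) × List Bool =>
      (y.1.1, y.1.2.2, y.2)) (by fun_prop)
  have hselected : Computable fun y : ((ℕ × List (List Bool) × List Bool) × List Bool) ×
      List Bool => r y.1.1.1 y.2 y.1.2 :=
    hr.comp (g := fun y : ((ℕ × List (List Bool) × List Bool) × List Bool) × List Bool =>
      (y.1.1.1, y.2, y.1.2)) (by fun_prop)
  have hall : Computable fun y : (ℕ × List (List Bool) × List Bool) × List Bool =>
      y.1.2.1.all fun ρ => !r y.1.1 ρ y.2 :=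
    computable_all (by fun_prop) (computable_not hselected)
  have hquery : Computable fun x : ℕ × List (List Bool) × List Bool =>
      (L x.1, (strings (N x.1)).filter fun τ => r x.1 x.2.2 τ && x.2.1.all fun ρ => !r x.1 ρ τ) :=
    (hL.comp Computable.fst).pair (computable_filter (by fun_prop)
      (computable_and hrelated hall))
  have hlen : Computable fun x : ℕ × List (List Bool) × List Bool =>
      decide (x.2.2.length = ℓ x.1) :=
    computable_decide_eq (by fun_prop) (by fun_prop)
  refine (rePred_and (rePred_of_computable hlen) (rePred_comp hM.rePred_lt_sum hquery)).of_eq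
    fun x => ?_
  simp only [fresh, stringsOf, Finset.sum, Finset.filter, Multiset.filter_coe, Multiset.map_coe,
    Multiset.sum_coe, Bool.decide_eq_true]

theorem exists_low_complexity_covering (hU : IsUniversalMachine U) (hM : IsSemimeasure M)
    (hM' : LowerSemicomputable M) (hN : Computable N) (hℓ : Computable ℓ) (hL : Computable L)
    (hr : Computable fun x : ℕ × List Bool × List Bool => r x.1 x.2.1 x.2.2) :
    ∃ c, ∀ m, ∃ A : List (List Bool),
      (∀ σ ∈ A, σ.length = ℓ m ∧ complexity U σ ≤ m + 1 + L m + c) ∧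
      ∀ σ, σ.length = ℓ m →
        ∑ τ ∈ fresh (r m) (stringsOf (N m)) A σ, M τ ≤ (1 / 2) ^ L m := by
  obtain ⟨A, hA, hgreedy, hprefix, hmaximal⟩ := exists_computable_greedy
    (P := fun m A σ => σ.length = ℓ m ∧
      (1 / 2) ^ L m < ∑ τ ∈ fresh (r m) (stringsOf (N m)) A σ, M τ)
    (hM'.rePred_lt_sum_fresh hN hℓ hL hr)
  have hcard : ∀ m i, (A m i).length ≤ 2 ^ L m := by
    intro m i
    have hheavy : IsGreedy (fun A σ =>
        (1 / 2) ^ L m ≤ ∑ τ ∈ fresh (r m) (stringsOf (N m)) A σ, M τ) (A m i) :=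
      fun l σ hl => (hgreedy m i l σ hl).2.le
    have hpack := (hheavy.length_mul_le_sum fun τ _ => hM.nonneg τ).trans
      (hM.sum_stringsOf_le_one (N m))
    rw [one_div, inv_pow, ← div_eq_mul_inv, div_le_one (by positivity)] at hpack
    exact_mod_cast hpack
  obtain ⟨c, hc⟩ := hU.exists_complexity_le_of_enumeration hL hA hprefix hcard
  refine ⟨c, fun m => ?_⟩
  obtain ⟨i, hi⟩ := hmaximal m _ (hcard m)
  exact ⟨A m i, fun σ hσ => ⟨(hgreedy m i).forall_mem (fun _ _ h => h.1) σ hσ, hc m i σ hσ⟩,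
    fun σ hσ => not_lt.1 fun hlt => hi σ ⟨hσ, hlt⟩⟩

end Covering

theorem IsSemimeasure.treeWeight_le_of_covering (hM : IsSemimeasure M)
    {r : List Bool → List Bool → Bool} {m n ℓ L : ℕ} {A : List (List Bool)}
    (hA : ∀ X ∈ C, ∀ σ ∈ A, r σ (restr X n) = false)
    (hfresh : ∀ σ, σ.length = ℓ →
      ∑ τ ∈ fresh r (stringsOf n) A σ, M τ ≤ (1 / 2) ^ L)
    (hcount : ∀ X ∈ C,
      2 ^ (m + ℓ) ≤ ({σ ∈ stringsOf ℓ | r σ (restr X n)} : Finset _).card * 2 ^ L) :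
    treeWeight M C n ≤ (1 / 2) ^ m := by
  classical
  have htree : ∀ τ ∈ ({τ ∈ stringsOf n | τ ∈ canonicalTree C} : Finset _),
      ∃ X ∈ C, restr X n = τ := by
    intro τ hτ
    obtain ⟨hlen, X, hX, hXτ⟩ := (Finset.mem_filter.1 hτ).imp_right mem_canonicalTree.1
    exact ⟨X, hX, mem_stringsOf.1 hlen ▸ hXτ⟩
  have hdouble : (2 ^ (m + ℓ) / 2 ^ L : ℝ) * treeWeight M C n ≤
      (stringsOf ℓ).card * (1 / 2) ^ L := by
    refine mul_sum_le_card_mul_of_forall_sum_le (r := r) (fun τ _ => hM.nonneg τ) ?_ ?_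
    · intro τ hτ
      obtain ⟨X, hX, rfl⟩ := htree τ hτ
      rw [div_le_iff₀ (by positivity)]
      exact_mod_cast hcount X hX
    · intro σ hσ
      refine le_trans (Finset.sum_le_sum_of_subset_of_nonneg ?_ fun τ _ _ => hM.nonneg τ)
        (hfresh σ (mem_stringsOf.1 hσ))
      intro τ hτ
      obtain ⟨hτ, hστ⟩ := Finset.mem_filter.1 hτ
      obtain ⟨X, hX, rfl⟩ := htree τ hτ
      have hmem := (Finset.mem_filter.1 hτ).1
      simpa [fresh, hmem, hστ] using hA X hX
  rw [card_stringsOf, pow_add] at hdouble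
  push_cast at hdouble
  simp only [one_div, inv_pow] at hdouble ⊢
  field_simp at hdouble ⊢
  linarith

theorem isDeep_of_complex_strings (hU : IsUniversalMachine U) (hM : IsSemimeasure M)
    (hM' : LowerSemicomputable M) (hC : IsPi01 C) {N ℓ L : ℕ → ℕ}
    {r : ℕ → List Bool → List Bool → Bool} (hN : Computable N) (hℓ : Computable ℓ)
    (hL : Computable L) (hr : Computable fun x : ℕ × List Bool × List Bool => r x.1 x.2.1 x.2.2)
    (hcount : ∀ X ∈ C, ∀ m, 2 ^ (m + ℓ m) ≤
      ({σ ∈ stringsOf (ℓ m) | r m σ (restr X (N m))} : Finset _).card * 2 ^ L m)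
    (hK : ∀ X ∈ C, ∀ m σ, σ.length = ℓ m → r m σ (restr X (N m)) →
      L m + 2 * m + 2 ≤ complexity U σ) : IsDeep M C := by
  obtain ⟨c, hc⟩ := exists_low_complexity_covering hU hM hM' hN hℓ hL hr
  refine hM.isDeep_of_treeWeight_le hC hN c fun m hm => ?_
  obtain ⟨A, hA, hfresh⟩ := hc m
  refine hM.treeWeight_le_of_covering (fun X hX σ hσ => ?_) hfresh fun X hX => hcount X hX m
  by_contra hσX
  have hlow := (hA σ hσ).2
  have hhigh := hK X hX m σ (hA σ hσ).1 (by simpa using hσX)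
  lia

open Classical in
theorem isDeep_charSeq_image (hU : IsUniversalMachine U) (hM : IsSemimeasure M)
    (hM' : LowerSemicomputable M) {α : Type} [Primcodable α] {𝒜 : Set (Set α)}
    (h𝒜 : IsPi01 (charSeq '' 𝒜)) {ℓ L : ℕ → ℕ} {q : ℕ → List Bool → List α} (hℓ : Computable ℓ)
    (hL : Computable L) (hq : Computable₂ q)
    (hcount : ∀ A ∈ 𝒜, ∀ m, 2 ^ (m + ℓ m) ≤
      ({σ ∈ stringsOf (ℓ m) | ∃ a ∈ q m σ, a ∈ A} : Finset _).card * 2 ^ L m)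
    (hK : ∀ A ∈ 𝒜, ∀ m σ, σ.length = ℓ m → (∃ a ∈ q m σ, a ∈ A) →
      L m + 2 * m + 2 ≤ complexity U σ) : IsDeep M (charSeq '' 𝒜) := by
  replace hq : Computable fun x : ℕ × List Bool => q x.1 x.2 := hq
  let codes (m : ℕ) : List ℕ := (strings (ℓ m)).flatMap fun σ => (q m σ).map encode
  let N (m : ℕ) : ℕ := (codes m).foldl (· + ·) 0 + 1
  let r (m : ℕ) (σ τ : List Bool) : Bool := !(q m σ).all fun a => !(τ[encode a]? == some true)
  have hr : Computable fun x : ℕ × List Bool × List Bool => r x.1 x.2.1 x.2.2 := by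
    have : Computable fun x : ℕ × List Bool × List Bool => q x.1 x.2.1 :=
      hq.comp (g := fun x : ℕ × List Bool × List Bool => (x.1, x.2.1)) (by fun_prop)
    fun_prop
  have hrestr : ∀ A m σ, σ.length = ℓ m →
      (r m σ (restr (charSeq A) (N m)) = true ↔ ∃ a ∈ q m σ, a ∈ A) := by
    intro A m σ hσ
    have hlt : ∀ a ∈ q m σ, encode a < N m := by
      intro a ha
      refine Nat.lt_succ_of_le ?_
      rw [← List.sum_eq_foldl]
      exact List.le_sum_of_mem (List.mem_flatMap.2 ⟨σ, mem_strings.2 hσ, List.mem_map_of_mem ha⟩)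
    simp only [r, Bool.not_eq_true', ← Bool.not_eq_true, List.all_eq_true]
    push Not
    refine exists_congr fun a => and_congr_right fun ha => ?_
    simp [getElem?_restr _ (hlt a ha), charSeq_encode]
  refine isDeep_of_complex_strings hU hM hM' h𝒜 (N := N) (r := r) (by fun_prop) hℓ hL hr ?_ ?_
  · rintro _ ⟨A, hA, rfl⟩ m
    rw [Finset.filter_congr fun σ hσ => hrestr A m σ (mem_stringsOf.1 hσ)]
    exact hcount A hA m
  · rintro _ ⟨A, hA, rfl⟩ m σ hσ hσA
    exact hK A hA m σ hσ ((hrestr A m σ hσ).1 hσA)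

end ComplexStrings

section ComplexSets

variable {U : List Bool →. List Bool} {f ℓ d : ℕ → ℕ}

open Classical in
theorem complexSetsClass_eq : complexSetsClass U f ℓ d = charSeq ''
    ({A | ∀ p ∈ A, p.2.length = ℓ p.1 ∧ ℓ p.1 - d p.1 ≤ complexity U p.2} ∩
      {A | ∀ i, ({σ ∈ stringsOf (ℓ i) | (i, σ) ∈ A} : Finset _).card = f i}) := by
  rw [complexSetsClass, ← Set.image_image charSeq fun F : ℕ → Finset (List Bool) =>
    {p : ℕ × List Bool | p.2 ∈ F p.1}]
  congr 1
  ext A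
  constructor
  · rintro ⟨F, hF, rfl⟩
    refine ⟨fun p hp => ?_, fun i => ?_⟩
    · obtain ⟨hlength, hK⟩ := (hF p.1).2 p.2 hp
      exact ⟨hlength, by omega⟩
    · rw [← (hF i).1]
      congr 1
      ext σ
      simpa using fun hσ => ((hF i).2 σ hσ).1
  · rintro ⟨hA, hcard⟩
    refine ⟨fun i => {σ ∈ stringsOf (ℓ i) | (i, σ) ∈ A}, fun i => ⟨hcard i, fun σ hσ => ?_⟩, ?_⟩
    · obtain ⟨hlength, hσA⟩ := by simpa using hσ
      have hK := (hA (i, σ) hσA).2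
      dsimp only at hK
      exact ⟨hlength, by omega⟩
    · ext p
      simpa using fun hp => (hA p hp).1

theorem isPi01_complexSetsClass (hU : IsUniversalMachine U) (hf : Computable f)
    (hℓ : Computable ℓ) (hd : Computable d) : IsPi01 (complexSetsClass U f ℓ d) := by
  classical
  rw [complexSetsClass_eq]
  refine isPi01_charSeq_image_inter ?_ ?_
  · have hP : REPred fun p : ℕ × List Bool =>
        ¬(p.2.length = ℓ p.1 ∧ ℓ p.1 - d p.1 ≤ complexity U p.2) := by
      simp only [not_and_or, not_le]
      exact rePred_or
        (rePred_not_of_computable (computable_decide_eq (by fun_prop) (by fun_prop)))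
        (rePred_comp hU.rePred_complexity_lt
          (f := fun p : ℕ × List Bool => (p.2, ℓ p.1 - d p.1)) (by fun_prop))
    simpa using isPi01_charSeq_image_clause (q := fun p => [p]) (q' := fun _ => [])
      (by fun_prop) (by fun_prop) hP
  · have hq : Computable fun i => (strings (ℓ i)).map fun σ => (i, σ) := by fun_prop
    have hP : REPred fun x : ℕ × List Bool => ¬(x.2.filter id).length = f x.1 :=
      rePred_not_of_computable (computable_decide_eq (by fun_prop) (by fun_prop))
    convert isPi01_charSeq_image (P := fun i l => (l.filter id).length = f i) hq hP using 5 with A i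
    rw [List.map_map, List.filter_map, List.length_map]
    simp [stringsOf, Finset.card, Finset.filter, Function.comp_def]

theorem exists_computable_two_pow_add_le {a : ℕ → ℕ} (hf : Computable f) (hd : Computable d)
    (hlarge : ∀ B : ℝ, ∃ i, B < (f i : ℝ) / 2 ^ d i) (ha : Computable a) :
    ∃ I : ℕ → ℕ, Computable I ∧ ∀ m, 2 ^ (d (I m) + a m) ≤ f (I m) := by
  have hf' : Computable fun p : ℕ × ℕ => f p.2 := hf.comp Computable.snd
  have : Computable fun p : ℕ × ℕ => d p.2 := hd.comp Computable.snd
  have : Computable fun p : ℕ × ℕ => a p.1 := ha.comp Computable.fst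
  have hle : Computable fun p : ℕ × ℕ => decide (2 ^ (d p.2 + a p.1) ≤ f p.2) :=
    computable_decide_le (by fun_prop) hf'
  obtain ⟨I, hI, hIf⟩ := exists_computable_forall hle fun m => by
    obtain ⟨i, hi⟩ := hlarge (2 ^ a m)
    rw [lt_div_iff₀ (by positivity), ← pow_add] at hi
    exact ⟨i, by rw [decide_eq_true_eq, add_comm]; exact_mod_cast hi.le⟩
  exact ⟨I, hI, fun m => of_decide_eq_true (hIf m)⟩

theorem isDeep_complexSetsClass (hU : IsUniversalMachine U) {M : List Bool → ℝ}
    (hM : IsSemimeasure M) (hM' : LowerSemicomputable M) (hf : Computable f) (hℓ : Computable ℓ)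
    (hd : Computable d) (hlarge : ∀ B : ℝ, ∃ i, B < (f i : ℝ) / 2 ^ d i) :
    IsDeep M (complexSetsClass U f ℓ d) := by
  classical
  obtain ⟨I, hI, hlargeI⟩ := exists_computable_two_pow_add_le hf hd hlarge
    (a := fun m => 3 * m + 2) (by fun_prop)
  have hℓI : Computable fun m => ℓ (I m) := hℓ.comp hI
  have : Computable fun m => d (I m) := hd.comp hI
  have hIσ : Computable fun x : ℕ × List Bool => [(I x.1, x.2)] := by fun_prop
  have hPi := isPi01_complexSetsClass hU hf hℓ hd
  rw [complexSetsClass_eq] at hPi ⊢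
  have hlength : ∀ A : Set (ℕ × List Bool),
      (∀ i, ({σ ∈ stringsOf (ℓ i) | (i, σ) ∈ A} : Finset _).card = f i) →
        ∀ m, d (I m) + (3 * m + 2) ≤ ℓ (I m) := fun A hA m => by
    have hle := Finset.card_filter_le (stringsOf (ℓ (I m))) fun σ => (I m, σ) ∈ A
    rw [hA, card_stringsOf] at hle
    exact (Nat.pow_le_pow_iff_right one_lt_two).1 ((hlargeI m).trans hle)
  refine isDeep_charSeq_image hU hM hM' hPi (ℓ := fun m => ℓ (I m))
    (L := fun m => ℓ (I m) - d (I m) - 2 * m - 2) (q := fun m σ => [(I m, σ)])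
    hℓI (by fun_prop) hIσ ?_ ?_
  · rintro A ⟨-, hcard⟩ m
    have hle := hlength A hcard m
    convert Nat.mul_le_mul_right (2 ^ (ℓ (I m) - d (I m) - 2 * m - 2)) (hlargeI m) using 1
    · rw [← pow_add]
      congr 1
      omega
    · congr 1
      rw [← hcard]
      simp
  · rintro A ⟨hA, hcard⟩ m σ - hσ
    have hle := hlength A hcard m
    have hK := (hA (I m, σ) (by simpa using hσ)).2
    dsimp only at hK
    omega

end ComplexSets

section CompressionFunctions

theorem summable_and_tsum_le_iff {ι : Type*} {w : ι → ℝ} (hw : ∀ i, 0 ≤ w i) {b : ℝ} :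
    (Summable w ∧ ∑' i, w i ≤ b) ↔ ∀ s : Finset ι, ∑ i ∈ s, w i ≤ b :=
  ⟨fun ⟨hsum, hle⟩ s => (hsum.sum_le_tsum s fun i _ => hw i).trans hle,
    fun h => ⟨summable_of_sum_le hw h, Real.tsum_le_of_sum_le hw h⟩⟩

theorem forall_finset_sum_le_iff_forall_graph {ι : Type*} {g : ι → ℕ} :
    (∀ s : Finset ι, ∑ i ∈ s, (1 / 2 : ℝ) ^ g i ≤ 1) ↔
      ∀ l : List (ι × ℕ), (∀ p ∈ l, g p.1 = p.2) → (l.map Prod.fst).Nodup →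
        (l.map fun p => (1 / 2 : ℚ) ^ p.2).sum ≤ 1 := by
  classical
  constructor
  · intro h l hl hnodup
    have hgraph : (l.map fun p => (1 / 2 : ℚ) ^ p.2) =
        (l.map Prod.fst).map fun i => (1 / 2 : ℚ) ^ g i := by
      rw [List.map_map]
      exact List.map_congr_left fun p hp => by rw [Function.comp_apply, hl p hp]
    rw [hgraph, ← List.sum_toFinset _ hnodup, ← Rat.cast_le (K := ℝ)]
    push_cast
    exact h _
  · intro h s
    have hs := h (s.toList.map fun i => (i, g i)) (by simp)
      (by simpa [Function.comp_def] using s.nodup_toList)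
    rw [List.map_map, Function.comp_def, Finset.sum_map_toList, ← Rat.cast_le (K := ℝ)] at hs
    push_cast at hs
    exact hs

theorem card_filter_lt_mul_two_le {ι : Type*} {g : ι → ℕ} {s : Finset ι}
    (hg : ∑ i ∈ s, (1 / 2 : ℝ) ^ g i ≤ 1) (n : ℕ) :
    ({i ∈ s | g i < n} : Finset ι).card * 2 ≤ 2 ^ n := by
  have hsum : ∑ i ∈ s with g i < n, (1 / 2 : ℝ) ^ n * 2 ≤ 1 := by
    refine (Finset.sum_le_sum fun i hi => ?_).trans
      ((Finset.sum_le_sum_of_subset_of_nonneg (Finset.filter_subset _ s)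
        fun i _ _ => by positivity).trans hg)
    have hlt := (Finset.mem_filter.1 hi).2
    calc (1 / 2 : ℝ) ^ n * 2 ≤ (1 / 2) ^ (g i + 1) * 2 :=
          mul_le_mul_of_nonneg_right
            (pow_le_pow_of_le_one (by norm_num) (by norm_num) hlt) (by norm_num)
      _ = (1 / 2) ^ g i := by ring
  rw [Finset.sum_const, nsmul_eq_mul, one_div, inv_pow, mul_left_comm, ← div_eq_inv_mul,
    div_le_one (by positivity)] at hsum
  exact_mod_cast hsum

variable {U : List Bool →. List Bool} {c : ℕ}

theorem compressionClass_eq {B : List Bool → ℕ} (hB : ∀ σ, complexity U σ < B σ) :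
    compressionClass U c = charSeq ''
      ({A | ∀ x : List Bool × ℕ × ℕ, (x.1, x.2.1) ∈ A → (x.1, x.2.2) ∈ A → x.2.1 = x.2.2} ∩
        {A | ∀ σ, ∃ n < B σ + c, (σ, n) ∈ A} ∩
        {A | ∀ p ∈ A, p.2 ≤ complexity U p.1 + c} ∩
        {A | ∀ l : List (List Bool × ℕ), (∀ p ∈ l, p ∈ A) → (l.map Prod.fst).Nodup →
          (l.map fun p => (1 / 2 : ℚ) ^ p.2).sum ≤ 1}) := by
  rw [compressionClass, ← Set.image_image charSeq fun g : List Bool → ℕ =>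
    {p : List Bool × ℕ | g p.1 = p.2}]
  congr 1
  ext A
  simp only [CompressionFunctions, summable_and_tsum_le_iff (fun _ => pow_nonneg one_half_pos.le _),
    forall_finset_sum_le_iff_forall_graph]
  constructor
  · rintro ⟨g, ⟨hK, hsum⟩, rfl⟩
    refine ⟨⟨⟨fun x h h' => h.symm.trans h', fun σ => ⟨g σ, ?_, rfl⟩⟩, fun p hp => ?_⟩, hsum⟩
    · exact (hK σ).trans_lt (Nat.add_lt_add_right (hB σ) c)
    · exact (hp : g p.1 = p.2) ▸ hK p.1
  · rintro ⟨⟨⟨huniq, hex⟩, hK⟩, hsum⟩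
    choose g _ hg using id hex
    have hA : {p : List Bool × ℕ | g p.1 = p.2} = A := Set.ext fun p =>
      ⟨fun (hp : g p.1 = p.2) => by simpa only [hp] using hg p.1,
        fun hp => huniq (p.1, _, _) (hg p.1) hp⟩
    refine ⟨g, ⟨fun σ => hK _ (hg σ), fun l hl => hsum l fun p hp => ?_⟩, hA⟩
    rw [← hA]
    exact hl p hp

theorem two_pow_le_card_filter_mul_two {g : List Bool → ℕ} (hg : g ∈ CompressionFunctions U c)
    (n : ℕ) : 2 ^ n ≤ ({σ ∈ stringsOf n | n ≤ g σ} : Finset _).card * 2 := by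
  have hsum := (summable_and_tsum_le_iff fun _ => pow_nonneg one_half_pos.le _).1 hg.2
  have hbad := card_filter_lt_mul_two_le (hsum (stringsOf n)) n
  have hsplit := Finset.card_filter_add_card_filter_not (s := stringsOf n) fun σ => n ≤ g σ
  rw [card_stringsOf] at hsplit
  simp only [not_le] at hsplit
  omega

theorem isPi01_compressionClass (hU : IsUniversalMachine U) (c : ℕ) :
    IsPi01 (compressionClass U c) := by
  obtain ⟨B, hB, hKB⟩ := hU.exists_computable_complexity_lt
  rw [compressionClass_eq hKB]
  refine isPi01_charSeq_image_inter (isPi01_charSeq_image_inter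
    (isPi01_charSeq_image_inter ?_ ?_) ?_) ?_
  · have hP : REPred fun x : List Bool × ℕ × ℕ => ¬x.2.1 = x.2.2 :=
      rePred_not_of_computable (computable_decide_eq (by fun_prop) (by fun_prop))
    simpa using isPi01_charSeq_image_clause (q := fun x => [(x.1, x.2.1), (x.1, x.2.2)])
      (q' := fun _ => []) (by fun_prop) (by fun_prop) hP
  · have hP : REPred fun _ : List Bool => ¬False :=
      rePred_not_of_computable (by fun_prop)
    simpa using isPi01_charSeq_image_clause (q := fun _ => [])
      (q' := fun σ => (List.range (B σ + c)).map fun n => (σ, n)) (by fun_prop) (by fun_prop) hP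
  · have hP : REPred fun p : List Bool × ℕ => ¬p.2 ≤ complexity U p.1 + c := by
      have hlt := rePred_and (rePred_of_computable (p := fun p : List Bool × ℕ => c < p.2)
        (by fun_prop)) (rePred_comp hU.rePred_complexity_lt
          (f := fun p : List Bool × ℕ => (p.1, p.2 - c)) (by fun_prop))
      exact hlt.of_eq fun p => by dsimp only; omega
    simpa using isPi01_charSeq_image_clause (q := fun p => [p]) (q' := fun _ => [])
      (by fun_prop) (by fun_prop) hP
  · have hP : REPred fun l : List (List Bool × ℕ) => ¬((l.map Prod.fst).Nodup →
        (l.map fun p => (1 / 2 : ℚ) ^ p.2).sum ≤ 1) := by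
      have hsum : Computable fun l : List (List Bool × ℕ) =>
          decide (1 < dyadic (dyadicSum (l.map fun p => (1, p.2)))) :=
        computable_lt_dyadic zero_le_one (by fun_prop)
      simp only [Classical.not_imp, not_le]
      simp only [dyadic_dyadicSum, List.map_map, Function.comp_def, dyadic_one] at hsum
      exact rePred_and (rePred_of_computable (computable_decide_nodup (by fun_prop)))
        (rePred_of_computable hsum)
    simpa using isPi01_charSeq_image_clause (q := fun l => l) (q' := fun _ => [])
      (by fun_prop) (by fun_prop) hP

theorem isDeep_compressionClass (hU : IsUniversalMachine U) {M : List Bool → ℝ}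
    (hM : IsSemimeasure M) (hM' : LowerSemicomputable M) (c : ℕ) :
    IsDeep M (compressionClass U c) := by
  obtain ⟨B, hB, hKB⟩ := hU.exists_computable_complexity_lt
  have hPi := isPi01_compressionClass hU c
  rw [compressionClass, ← Set.image_image charSeq fun g : List Bool → ℕ =>
    {p : List Bool × ℕ | g p.1 = p.2}] at hPi ⊢
  have hmem : ∀ g ∈ CompressionFunctions U c, ∀ m σ,
      (∃ a ∈ (List.range (B σ)).map fun n => (σ, c + 3 * m + 3 + n), a ∈ {p | g p.1 = p.2}) ↔
        c + 3 * m + 3 ≤ g σ := fun g hg m σ => by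
    have hK := hg.1 σ
    have hKσ := hKB σ
    simp only [List.mem_map, List.mem_range, exists_exists_and_eq_and, Set.mem_ofPred_eq]
    exact ⟨fun ⟨n, _, hn⟩ => by omega, fun h => ⟨g σ - (c + 3 * m + 3), by omega, by omega⟩⟩
  have : Computable fun x : ℕ × List Bool => B x.2 := hB.comp Computable.snd
  have hq : Computable₂ fun (m : ℕ) (σ : List Bool) =>
      (List.range (B σ)).map fun n => (σ, c + 3 * m + 3 + n) :=
    computable_map (l := fun x : ℕ × List Bool => List.range (B x.2)) (by fun_prop) (by fun_prop)
  refine isDeep_charSeq_image hU hM hM' hPi (ℓ := fun m => c + 3 * m + 3) (L := fun m => m + 1)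
    (by fun_prop) (by fun_prop) hq ?_ ?_
  · rintro _ ⟨g, hg, rfl⟩ m
    simp only [hmem g hg]
    rw [pow_succ', ← mul_assoc, pow_add, mul_comm]
    exact Nat.mul_le_mul_right _ (two_pow_le_card_filter_mul_two hg _)
  · rintro _ ⟨g, hg, rfl⟩ m σ - hσ
    have hle := (hmem g hg m σ).1 hσ
    have hK := hg.1 σ
    omega

end CompressionFunctions

section Martingales

theorem IsMartingale.sum_stringsOf {D : List Bool → ℚ} (hD : IsMartingale D) (n : ℕ) :
    ∑ σ ∈ stringsOf n, D σ = 2 ^ n * D [] := by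
  induction n with
  | zero => simp [stringsOf, strings]
  | succ n ih =>
    rw [sum_stringsOf_succ, Finset.sum_congr rfl fun σ _ => (hD.fair σ).symm, ← Finset.mul_sum,
      ih, pow_succ', mul_assoc]

theorem IsMartingale.card_filter_lt_mul_le {D : List Bool → ℚ} (hD : IsMartingale D) (b : ℚ)
    (n : ℕ) : ({σ ∈ stringsOf n | b < D σ} : Finset _).card * b ≤ 2 ^ n * D [] := by
  rw [← nsmul_eq_mul, ← Finset.sum_const, ← hD.sum_stringsOf]
  exact (Finset.sum_le_sum fun σ hσ => (Finset.mem_filter.1 hσ).2.le).trans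
    (Finset.sum_le_sum_of_subset_of_nonneg (Finset.filter_subset _ _) fun σ _ _ => hD.nonneg σ)

theorem IsMartingale.two_pow_le_card_filter_le_mul {D : List Bool → ℚ} (hD : IsMartingale D)
    (hroot : D [] = 1) {r : ℚ} (hr : 0 < r) {e : ℕ} (he : 1 + r ≤ 2 ^ e * r) (n : ℕ) :
    2 ^ n ≤ ({σ ∈ stringsOf n | D σ ≤ 1 + r} : Finset _).card * 2 ^ e := by
  have hmarkov := hD.card_filter_lt_mul_le (1 + r) n
  have hsplit := Finset.card_filter_add_card_filter_not (s := stringsOf n) fun σ => 1 + r < D σ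
  rw [card_stringsOf] at hsplit
  simp only [not_lt] at hsplit
  set large := ({σ ∈ stringsOf n | 1 + r < D σ} : Finset _).card
  set small := ({σ ∈ stringsOf n | D σ ≤ 1 + r} : Finset _).card
  have hsplit' : (large + small : ℚ) = 2 ^ n := by exact_mod_cast hsplit
  have hmain : (2 ^ n : ℚ) * r ≤ small * 2 ^ e * r := calc
    (2 ^ n : ℚ) * r ≤ small * (1 + r) := by
      rw [hroot] at hmarkov
      linear_combination hmarkov - (1 + r) * hsplit'
    _ ≤ small * (2 ^ e * r) := mul_le_mul_of_nonneg_left he (Nat.cast_nonneg _)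
    _ = small * 2 ^ e * r := (mul_assoc ..).symm
  exact_mod_cast le_of_mul_le_mul_right hmain hr

variable {U : List Bool →. List Bool} {ν : List Bool → ℕ × ℕ} {g : ℕ → ℕ} {r : ℚ}

theorem martingaleClass_eq : martingaleClass U ν g r = charSeq ''
    ({A | ∀ σ p q, (σ, p) ∈ A → (σ, q) ∈ A → dyadic p = dyadic q} ∩
      {A | ∀ σ p q, (σ, p) ∈ A → dyadic p ≠ dyadic q ∨ (σ, q) ∈ A} ∩
      {A | ∀ σ, ∃ τ ∈ strings (g σ.length), (σ, ν τ) ∈ A} ∩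
      {A | ∀ σ p q q', (σ, p) ∈ A → (σ ++ [false], q) ∈ A → (σ ++ [true], q') ∈ A →
        2 * dyadic p = dyadic q + dyadic q'} ∩
      {A | ([], (1, 0)) ∈ A} ∩
      {A | ∀ σ p, (σ, p) ∈ A → σ.length ≤ complexity U σ ∨ 1 + r < dyadic p}) := by
  rw [martingaleClass, ← Set.image_image charSeq fun D : List Bool → ℚ =>
    {p : List Bool × ℕ × ℕ | D p.1 = dyadic p.2}]
  congr 1
  ext A
  constructor
  · rintro ⟨D, ⟨hD, hroot, hdom, hcode⟩, rfl⟩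
    refine ⟨⟨⟨⟨⟨fun σ p q hp hq => hp.symm.trans hq, fun σ p q hp => ?_⟩, fun σ => ?_⟩,
      fun σ p q q' hp hq hq' => ?_⟩, ?_⟩, fun σ p hp => ?_⟩
    · exact (ne_or_eq _ _).imp_right hp.trans
    · obtain ⟨τ, hτ, hDτ⟩ := hcode σ
      exact ⟨τ, mem_strings.2 hτ, hDτ⟩
    · rw [← (hp : D σ = _), ← (hq : D _ = _), ← (hq' : D _ = _), hD.fair]
    · simp [hroot, dyadic_one]
    · exact (le_or_gt _ _).imp_right fun hlt => (hdom σ hlt).trans_eq hp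
  · rintro ⟨⟨⟨⟨⟨huniq, hclosed⟩, hex⟩, hfair⟩, hroot⟩, hdom⟩
    choose τ hτ hA using id hex
    refine ⟨fun σ => dyadic (ν (τ σ)), ⟨⟨fun σ => dyadic_nonneg _, fun σ => ?_⟩, ?_, fun σ hσ => ?_,
      fun σ => ⟨τ σ, mem_strings.1 (hτ σ), rfl⟩⟩, Set.ext fun p => ⟨fun hp => ?_, fun hp => ?_⟩⟩
    · exact hfair _ _ _ _ (hA _) (hA _) (hA _)
    · exact (huniq _ _ _ (hA _) hroot).trans (by simp [dyadic_one])
    · exact (hdom _ _ (hA σ)).resolve_left hσ.not_ge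
    · exact (hclosed _ _ _ (hA p.1)).resolve_left (not_not_intro hp)
    · exact huniq _ _ _ (hA p.1) hp

theorem IsUniversalMachine.rePred_complexity_lt_length_and_dyadic_le (hU : IsUniversalMachine U)
    (hr : 0 < r) : REPred fun x : List Bool × ℕ × ℕ =>
      complexity U x.1 < x.1.length ∧ ¬1 + r < dyadic x.2 :=
  rePred_and (rePred_comp hU.rePred_complexity_lt
      (f := fun x : List Bool × ℕ × ℕ => (x.1, x.1.length)) (by fun_prop))
    (rePred_not_of_computable (computable_lt_dyadic (by positivity) (by fun_prop)))

theorem isPi01_martingaleClass (hU : IsUniversalMachine U) (hν : Computable ν)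
    (hg : Computable g) (hr : 0 < r) : IsPi01 (martingaleClass U ν g r) := by
  rw [martingaleClass_eq]
  have heq : Computable fun x : List Bool × (ℕ × ℕ) × ℕ × ℕ =>
      decide (dyadic x.2.1 = dyadic x.2.2) := computable_dyadic_eq (by fun_prop) (by fun_prop)
  refine isPi01_charSeq_image_inter (isPi01_charSeq_image_inter (isPi01_charSeq_image_inter
    (isPi01_charSeq_image_inter (isPi01_charSeq_image_inter ?_ ?_) ?_) ?_) ?_) ?_
  · simpa using isPi01_charSeq_image_clause (q := fun x => [(x.1, x.2.1), (x.1, x.2.2)])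
      (q' := fun _ => []) (by fun_prop) (by fun_prop) (rePred_not_of_computable heq)
  · have hP : REPred fun x : List Bool × (ℕ × ℕ) × ℕ × ℕ => ¬dyadic x.2.1 ≠ dyadic x.2.2 := by
      simpa only [not_not] using rePred_of_computable heq
    simpa using isPi01_charSeq_image_clause (q := fun x => [(x.1, x.2.1)])
      (q' := fun x => [(x.1, x.2.2)]) (by fun_prop) (by fun_prop) hP
  · have hq' : Computable fun σ : List Bool => (strings (g σ.length)).map fun τ => (σ, ν τ) := by
      fun_prop
    have hP : REPred fun _ : List Bool => ¬False := rePred_not_of_computable (by fun_prop)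
    simpa using isPi01_charSeq_image_clause (q := fun _ => []) (by fun_prop) hq' hP
  · have hP : REPred fun x : List Bool × (ℕ × ℕ) × (ℕ × ℕ) × ℕ × ℕ =>
        ¬2 * dyadic x.2.1 = dyadic x.2.2.1 + dyadic x.2.2.2 := by
      simp only [two_mul, ← dyadic_dyadicAdd]
      exact rePred_not_of_computable (computable_dyadic_eq (by fun_prop) (by fun_prop))
    simpa using isPi01_charSeq_image_clause
      (q := fun x => [(x.1, x.2.1), (x.1 ++ [false], x.2.2.1), (x.1 ++ [true], x.2.2.2)])
      (q' := fun _ => []) (by fun_prop) (by fun_prop) hP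
  · have hP : REPred fun _ : Unit => ¬False := rePred_not_of_computable (by fun_prop)
    simpa [Unique.forall_iff] using isPi01_charSeq_image_clause (q := fun _ => [])
      (q' := fun _ => [(([] : List Bool), (1, 0))]) (by fun_prop) (by fun_prop) hP
  · have hP : REPred fun x : List Bool × ℕ × ℕ =>
        ¬(x.1.length ≤ complexity U x.1 ∨ 1 + r < dyadic x.2) := by
      simpa only [not_or, not_le] using hU.rePred_complexity_lt_length_and_dyadic_le hr
    simpa using isPi01_charSeq_image_clause (q := fun x => [x]) (q' := fun _ => [])
      (by fun_prop) (by fun_prop) hP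

theorem exists_mem_small_codes_iff {D : List Bool → ℚ} (hD : D ∈ DominatingMartingales U ν g r)
    (σ : List Bool) : (∃ a ∈ ((strings (g σ.length)).filter fun τ =>
      !decide (1 + r < dyadic (ν τ))).map fun τ => (σ, ν τ), a ∈ {p | D p.1 = dyadic p.2}) ↔
      D σ ≤ 1 + r := by
  obtain ⟨-, -, -, hcode⟩ := hD
  simp only [List.mem_map, List.mem_filter, mem_strings, exists_exists_and_eq_and,
    Set.mem_ofPred_eq, Bool.not_eq_true', decide_eq_false_iff_not, not_lt]
  refine ⟨fun ⟨τ, ⟨_, hle⟩, hD⟩ => hD.trans_le hle, fun hle => ?_⟩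
  obtain ⟨τ, hτ, hD⟩ := hcode σ
  exact ⟨τ, ⟨hτ, hD.symm.trans_le hle⟩, hD⟩

theorem isDeep_martingaleClass (hU : IsUniversalMachine U) {M : List Bool → ℝ}
    (hM : IsSemimeasure M) (hM' : LowerSemicomputable M) (hν : Computable ν) (hg : Computable g)
    (hr : 0 < r) : IsDeep M (martingaleClass U ν g r) := by
  have hPi := isPi01_martingaleClass hU hν hg hr
  rw [martingaleClass, ← Set.image_image charSeq fun D : List Bool → ℚ =>
    {p : List Bool × ℕ × ℕ | D p.1 = dyadic p.2}] at hPi ⊢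
  obtain ⟨e, he⟩ : ∃ e : ℕ, 1 + r ≤ 2 ^ e * r := by
    obtain ⟨e, he⟩ := pow_unbounded_of_one_lt ((1 + r) / r) one_lt_two
    exact ⟨e, ((div_lt_iff₀ hr).1 he).le⟩
  have hlt : Computable fun τ => decide (1 + r < dyadic (ν τ)) :=
    computable_lt_dyadic (by positivity) hν
  have hq : Computable₂ fun (_ : ℕ) (σ : List Bool) => ((strings (g σ.length)).filter fun τ =>
      !decide (1 + r < dyadic (ν τ))).map fun τ => (σ, ν τ) := by
    have hstrings : Computable fun x : ℕ × List Bool => strings (g x.2.length) := by fun_prop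
    have hnot : Computable fun x : (ℕ × List Bool) × List Bool =>
      !decide (1 + r < dyadic (ν x.2)) := computable_not (hlt.comp Computable.snd)
    exact computable_map (computable_filter hstrings hnot) (by fun_prop)
  refine isDeep_charSeq_image hU hM hM' hPi (ℓ := fun m => 3 * m + e + 2) (L := fun m => m + e)
    (by fun_prop) (by fun_prop) hq ?_ ?_
  · rintro _ ⟨D, hD, rfl⟩ m
    simp only [exists_mem_small_codes_iff hD]
    rw [pow_add, pow_add 2 m e, mul_left_comm]
    exact Nat.mul_le_mul_left _ (hD.1.two_pow_le_card_filter_le_mul hD.2.1 hr he _)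
  · rintro _ ⟨D, hD, rfl⟩ m σ hlength hσ
    have hle : ¬complexity U σ < σ.length := fun hlt =>
      (hD.2.2.1 σ hlt).not_ge ((exists_mem_small_codes_iff hD σ).1 hσ)
    omega

end Martingales

end DeepClasses

open DeepClasses in
theorem mainTheorem9_general
    {U : List Bool →. List Bool} (hU : IsUniversalMachine U)
    {M : List Bool → ℝ} (hM : IsSemimeasure M) (hM' : LowerSemicomputable M) :
    (∀ f ℓ d : ℕ → ℕ, Computable f → Computable ℓ → Computable d →
      (∀ B : ℝ, ∃ i, B < (f i : ℝ) / 2 ^ d i) →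
      IsDeep M (complexSetsClass U f ℓ d)) ∧
    (∀ c : ℕ, IsDeep M (compressionClass U c)) ∧
    (∀ (ν : List Bool → ℕ × ℕ) (g : ℕ → ℕ) (r : ℚ), Computable ν → Computable g → 0 < r →
      IsDeep M (martingaleClass U ν g r)) :=
  ⟨fun _ _ _ hf hℓ hd hlarge => isDeep_complexSetsClass hU hM hM' hf hℓ hd hlarge,
    fun c => isDeep_compressionClass hU hM hM' c,
    fun _ _ _ hν hg hr => isDeep_martingaleClass hU hM hM' hν hg hr⟩

open DeepClasses in
theorem mainTheorem9
    (U : List Bool →. List Bool) (hU : IsUniversalMachine U)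
    (M : List Bool → ℝ) (hM : IsUniversalSemimeasure M) :
    (∀ f ℓ d : ℕ → ℕ, Computable f → Computable ℓ → Computable d → Monotone ℓ →
      (∀ B : ℝ, ∃ i, B < (f i : ℝ) / 2 ^ d i) →
      IsDeep M (complexSetsClass U f ℓ d)) ∧
    (∀ c : ℕ, IsDeep M (compressionClass U c)) ∧
    (∀ (ν : List Bool → ℕ × ℕ) (g : ℕ → ℕ) (r : ℚ), Computable ν → Computable g → 0 < r →
      IsDeep M (martingaleClass U ν g r)) :=
  have h := mainTheorem9_general hU hM.semimeasure hM.lowerSemicomputable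
  ⟨fun f ℓ d hf hℓ hd _ => h.1 f ℓ d hf hℓ hd, h.2⟩
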